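/- All graphs are finite and simple. A graph $G$ is $(a,b)$-choosable if, for every assignment $L$ of a set $L(v)$ of $a$ colors to each vertex $v$, there are sets $\varphi(v)\subseteq L(v)$ with $|\varphi(v)|=b$ for all $v\in V(G)$ such that $\varphi(v)\cap\varphi(w)=\emptyset$ for every edge $vw$. A graph is 2-connected if it is connected and has no cut-vertex. For positive integers $\ell_1,\dots,\ell_k$, at most one of them equal to $1$, let $\theta_{\ell_1,\dots,\ell_k}$ be the graph formed from vertex-disjoint paths of lengths $\ell_1,\dots,\ell_k$ by identifying one endpoint of each path into a single vertex and the other endpoint of each path into a second vertex. Let $K_{3,3}-e$ be the graph formed from $K_{3,3}$ by deleting one edge. **Theorem.** Let $G$ be a 2-connected graph with at least three vertices. If $G$ is $(4,2)$-choosable, then $G$ is isomorphic to one of the following graphs: 1. the cycle $C_{2s}$ for some integer $s\ge 2$; 2. $\theta_{2,2s,2t}$ for some integers $s,t\ge 1$; 3. $\theta_{1,2s+1,2t+1}$ for some integers $s,t\ge 1$; 4. $\theta_{2,2,2,2}$; 5. a graph formed from $K_{3,3}-e$ by choosing a single edge incident to a vertex of degree $2$ and subdividing it an even number of times (possibly zero),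 i.e. replacing it by a path of odd length with new interior vertices. -/

import Mathlib

namespace SimpleGraph

/-- `v` is a cut-vertex of `G` if `G - v` is disconnected. -/
def IsCutVertex {V : Type*} (G : SimpleGraph V) (v : V) : Prop :=
  ¬ (G.induce {w | w ≠ v}).Preconnected

/-- A graph is 2-connected if it is connected and has no cut-vertex. -/
def IsTwoConnected {V : Type*} (G : SimpleGraph V) : Prop :=
  G.Connected ∧ ∀ v, ¬ G.IsCutVertex v

/-- `φ` is a `b`-fold `L`-coloring of `G`: every vertex receives a `b`-subset of its list, and
adjacent vertices receive disjoint sets. -/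
def IsFoldListColoring {V : Type*} (G : SimpleGraph V) (b : ℕ) (L φ : V → Finset ℕ) : Prop :=
  (∀ v, φ v ⊆ L v ∧ (φ v).card = b) ∧ ∀ v w, G.Adj v w → Disjoint (φ v) (φ w)

/-- `(a, b)`-choosability; the colors are natural numbers. -/
def IsChoosable {V : Type*} (G : SimpleGraph V) (a b : ℕ) : Prop :=
  ∀ L : V → Finset ℕ, (∀ v, (L v).card = a) → ∃ φ : V → Finset ℕ, G.IsFoldListColoring b L φ

/-- The vertices of the graph formed by `k` paths of positive lengths `ℓ 0, …, ℓ (k - 1)` with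
common endpoints: `inl false` and `inl true` are the two common endpoints, and the `i`-th path has
`ℓ i - 1` interior vertices. -/
abbrev ThetaVert {k : ℕ} (ℓ : Fin k → ℕ) : Type :=
  Bool ⊕ (Σ i : Fin k, Fin (ℓ i - 1))

/-- The vertex at distance `j` from the start along the `i`-th path, for `0 ≤ j ≤ ℓ i`. -/
def thetaVert {k : ℕ} (ℓ : Fin k → ℕ) (i : Fin k) (j : ℕ) : ThetaVert ℓ :=
  if h0 : j = 0 then Sum.inl false
  else if h : j < ℓ i then Sum.inr ⟨i, ⟨j - 1, by omega⟩⟩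
  else Sum.inl true

/-- The generalized theta graph `θ_{ℓ 0, …, ℓ (k - 1)}`. -/
def thetaGraph {k : ℕ} (ℓ : Fin k → ℕ) : SimpleGraph (ThetaVert ℓ) :=
  fromEdgeSet {e | ∃ i, ∃ j < ℓ i, e = s(thetaVert ℓ i j, thetaVert ℓ i (j + 1))}

/-- The `j`-th vertex, for `0 ≤ j ≤ n + 1`, of the path from `u` to `v` through `n` new vertices. -/
def subdivVert {V : Type*} (u v : V) (n : ℕ) (j : ℕ) : V ⊕ Fin n :=
  if h0 : j = 0 then Sum.inl u
  else if h : j ≤ n then Sum.inr ⟨j - 1, by omega⟩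
  else Sum.inl v

/-- The graph formed from `G` by subdividing the edge `uv` a total of `n` times, that is, by
replacing it with a path of length `n + 1` whose `n` interior vertices are new. -/
def subdivideEdge {V : Type*} (G : SimpleGraph V) (u v : V) (n : ℕ) : SimpleGraph (V ⊕ Fin n) :=
  fromEdgeSet (Sym2.map Sum.inl '' (G.edgeSet \ {s(u, v)}) ∪
    {e | ∃ j ≤ n, e = s(subdivVert u v n j, subdivVert u v n (j + 1))})

/-- The graph `K_{3,3} - e`. -/
def K33MinusEdge : SimpleGraph (Fin 3 ⊕ Fin 3) :=
  (completeBipartiteGraph (Fin 3) (Fin 3)).deleteEdges {s(Sum.inl 0, Sum.inr 0)}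

end SimpleGraph

/-! The engine is a shortening principle. If adjacent vertices carry the same list of four colors,
their 2-sets are complementary in it, so two further steps along a path with constant lists bring
the first set back. A path can therefore imitate a path shorter by an even number of edges: a bad
list assignment for a short graph lifts to every graph obtained by lengthening its arcs evenly
(`exists_collapse`). Excluding an infinite family of configurations then takes finitely many
explicit list assignments, each refuted by a backtracking search that the kernel evaluates.

Constant lists of size four show that the graph is bipartite. Fix a longest cycle C. A path of
length at least three with only its two distinct ends on C either gives a longer cycle or a theta
graph whose three paths all have length at least three, and the latter shortens to θ_{3,3,3} or
θ_{4,4,4}, which have bad lists. Hence the vertices off C are pairwise nonadjacent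
(`IsCyc.not_adj_of_not_mem`), and by 2-connectedness each has at least two neighbors on C.

The searches bound what C can carry: an outside vertex has at most two neighbors on C and excludes
chords; two outside vertices force C to have length four; three of them with the same two neighbors
give K_{2,5}, which has bad lists. Two chords must cross, with three consecutive arcs of lengths 1,
2, 1; a third chord would give K_{3,3}, which also has bad lists. What survives is a bare cycle, a
cycle with one outside vertex or one chord (a theta graph), θ_{2,2,2,2}, and C with two chords, a
subdivision of K_{3,3} - e. -/

namespace SimpleGraph

/-! ### Backtracking search for 2-fold colorings -/

/-- Two pairs of colors have no color in common. -/
def pairDisjoint (p q : ℕ × ℕ) : Bool :=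
  !(Nat.beq p.1 q.1) && !(Nat.beq p.1 q.2) && !(Nat.beq p.2 q.1) && !(Nat.beq p.2 q.2)

/-- The two-element sublists of a list. -/
def pairsOf : List ℕ → List (ℕ × ℕ)
  | [] => []
  | a :: l => l.map (fun b => (a, b)) ++ pairsOf l

/-- Backtracking search for a 2-fold list coloring. An instance lists for every vertex its colors
and the indices of its neighbors that come earlier. -/
def search : List (List ℕ × List ℕ) → List (ℕ × ℕ) → Bool
  | [], _ => true
  | (l, nb) :: rest, asg =>
    (pairsOf l).any fun p =>
      (nb.all fun k => pairDisjoint p (asg.getD k (0, 0))) && search rest (asg ++ [p])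

theorem pairDisjoint_of_disjoint {p q : ℕ × ℕ}
    (h : Disjoint ({p.1, p.2} : Finset ℕ) {q.1, q.2}) : pairDisjoint p q = true := by
  simp only [Finset.disjoint_left, Finset.mem_insert, Finset.mem_singleton, not_or,
    forall_eq_or_imp, forall_eq] at h
  have hb : ∀ {a b : ℕ}, a ≠ b → (!(Nat.beq a b)) = true := fun hab => by
    rw [Bool.not_eq_true', ← Bool.not_eq_true, Nat.beq_eq]; exact hab
  simp only [pairDisjoint, Bool.and_eq_true]
  exact ⟨⟨⟨hb h.1.1, hb h.1.2⟩, hb h.2.1⟩, hb h.2.2⟩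

theorem mem_pairsOf_or {l : List ℕ} {x y : ℕ} (hx : x ∈ l) (hy : y ∈ l) (hxy : x ≠ y) :
    (x, y) ∈ pairsOf l ∨ (y, x) ∈ pairsOf l := by
  induction l with
  | nil => simp at hx
  | cons a l ih =>
    simp only [pairsOf, List.mem_append, List.mem_map, Prod.mk.injEq]
    rcases List.mem_cons.1 hx with rfl | hx'
    · rcases List.mem_cons.1 hy with rfl | hy'
      · exact absurd rfl hxy
      · exact Or.inl (Or.inl ⟨y, hy', rfl, rfl⟩)
    · rcases List.mem_cons.1 hy with rfl | hy'
      · exact Or.inr (Or.inl ⟨x, hx', rfl, rfl⟩)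
      · rcases ih hx' hy' with h | h
        · exact Or.inl (Or.inr h)
        · exact Or.inr (Or.inr h)

theorem exists_mem_pairsOf {l : List ℕ} {s : Finset ℕ} (hs : s ⊆ l.toFinset) (hc : s.card = 2) :
    ∃ p ∈ pairsOf l, s = {p.1, p.2} := by
  obtain ⟨x, y, hxy, rfl⟩ := Finset.card_eq_two.1 hc
  have hx : x ∈ l := List.mem_toFinset.1 (hs (by simp))
  have hy : y ∈ l := List.mem_toFinset.1 (hs (by simp))
  rcases mem_pairsOf_or hx hy hxy with h | h
  · exact ⟨_, h, rfl⟩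
  · exact ⟨_, h, Finset.pair_comm _ _⟩

/-- At every vertex the pair used by `c` is one of the branches tried, so following `c` never fails.
Only this direction is needed: a search that returns `false` certifies that the lists are bad. -/
theorem search_of_coloring (c : ℕ → Finset ℕ) (inst : List (List ℕ × List ℕ))
    (asg : List (ℕ × ℕ))
    (hasg : ∀ k < asg.length, c k = {(asg.getD k (0, 0)).1, (asg.getD k (0, 0)).2})
    (hsub : ∀ i (hi : i < inst.length), c (asg.length + i) ⊆ inst[i].1.toFinset ∧
      (c (asg.length + i)).card = 2)
    (hdis : ∀ i (hi : i < inst.length), ∀ k ∈ inst[i].2, k < asg.length + i ∧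
      Disjoint (c (asg.length + i)) (c k)) :
    search inst asg = true := by
  induction inst generalizing asg with
  | nil => rfl
  | cons a rest ih =>
    obtain ⟨l, nb⟩ := a
    simp only [search, List.any_eq_true, Bool.and_eq_true, List.all_eq_true]
    have h0 := hsub 0 (by simp)
    simp only [List.getElem_cons_zero, add_zero] at h0
    obtain ⟨p, hp, hcp⟩ := exists_mem_pairsOf h0.1 h0.2
    have hd0 := hdis 0 (by simp)
    simp only [List.getElem_cons_zero, add_zero] at hd0
    refine ⟨p, hp, fun k hk => ?_, ih (asg ++ [p]) ?_ ?_ ?_⟩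
    · obtain ⟨hlt, hdk⟩ := hd0 k hk
      rw [hcp, hasg k hlt] at hdk
      exact pairDisjoint_of_disjoint hdk
    · intro k hk
      simp only [List.length_append, List.length_singleton] at hk
      rcases Nat.lt_succ_iff_lt_or_eq.1 hk with hk' | rfl
      · rw [hasg k hk', List.getD_append _ _ _ _ hk']
      · rw [hcp, List.getD_append_right _ _ _ _ le_rfl]
        simp
    · intro i hi
      have := hsub (i + 1) (by simpa using hi)
      simpa [add_assoc, add_comm 1 i] using this
    · intro i hi k hk
      have := hdis (i + 1) (by simpa using hi) k (by simpa using hk)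
      simpa [add_assoc, add_comm 1 i] using this

/-! ### Shortening paths and cycles -/

/-- Along a path on which lists repeat while `m` is constant, a 2-fold coloring from lists of size
four is determined by a coloring of the shorter path with the repetitions removed. -/
theorem exists_collapse {V : Type*} (u : ℕ → V) (m : ℕ → ℕ) (N : ℕ) (Λ : ℕ → Finset ℕ)
    (hΛ : ∀ j, (Λ j).card = 4) (ψ : V → Finset ℕ) (h0 : m 0 = 0)
    (hm : ∀ i < N, m (i + 1) = m i ∨ (m (i + 1) = m i + 1 ∧ (i + m i) % 2 = 0))
    (hψ : ∀ i ≤ N, ψ (u i) ⊆ Λ (m i) ∧ (ψ (u i)).card = 2)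
    (hd : ∀ i < N, Disjoint (ψ (u i)) (ψ (u (i + 1)))) :
    ∃ φ : ℕ → Finset ℕ, (∀ j ≤ m N, φ j ⊆ Λ j ∧ (φ j).card = 2) ∧
      (∀ j < m N, Disjoint (φ j) (φ (j + 1))) ∧
      ∀ i ≤ N, (i + m i) % 2 = 0 → ψ (u i) = φ (m i) := by
  -- The parity of `i + m i` is that of the number of edges suppressed so far. The induction must
  -- also track the odd vertices, which carry the complement of `φ (m i)` in the list; `m` may
  -- advance only at even ones.
  suffices h : ∃ φ : ℕ → Finset ℕ, (∀ j ≤ m N, φ j ⊆ Λ j ∧ (φ j).card = 2) ∧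
      (∀ j < m N, Disjoint (φ j) (φ (j + 1))) ∧
      ∀ i ≤ N, m i ≤ m N ∧ ((i + m i) % 2 = 0 → ψ (u i) = φ (m i)) ∧
        ((i + m i) % 2 = 1 → ψ (u i) = Λ (m i) \ φ (m i)) by
    obtain ⟨φ, h1, h2, h3⟩ := h
    exact ⟨φ, h1, h2, fun i hi => (h3 i hi).2.1⟩
  induction N with
  | zero =>
    refine ⟨fun _ => ψ (u 0), ?_, ?_, ?_⟩
    · intro j hj
      have hj0 : j = 0 := by omega
      subst hj0
      have := hψ 0 le_rfl
      rwa [h0] at this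
    · intro j hj; omega
    · intro i hi
      have hi0 : i = 0 := by omega
      subst hi0
      refine ⟨le_rfl, fun _ => rfl, fun h => ?_⟩
      rw [h0] at h; omega
  | succ N ih =>
    obtain ⟨φ, h1, h2, h3⟩ := ih (fun i hi => hm i (by omega)) (fun i hi => hψ i (by omega))
      (fun i hi => hd i (by omega))
    obtain ⟨-, h3e, h3o⟩ := h3 N le_rfl
    have hdN := hd N (by omega)
    obtain ⟨hsN, hcN⟩ := hψ (N + 1) le_rfl
    rcases hm N (by omega) with hs | ⟨hs, hpar⟩
    · rw [hs] at hsN ⊢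
      obtain ⟨hφs, hφc⟩ := h1 (m N) le_rfl
      refine ⟨φ, h1, h2, fun i hi => ?_⟩
      rcases (by omega : i ≤ N ∨ i = N + 1) with hi' | rfl
      · exact h3 i hi'
      · rw [hs]
        refine ⟨le_rfl, fun hp => ?_, fun hp => ?_⟩
        · have h := h3o (by omega)
          rw [h] at hdN
          refine Finset.eq_of_subset_of_card_le (fun x hx => ?_) (by omega)
          by_contra hx'
          exact Finset.disjoint_left.1 hdN (Finset.mem_sdiff.2 ⟨hsN hx, hx'⟩) hx
        · have h := h3e (by omega)
          rw [h] at hdN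
          refine Finset.eq_of_subset_of_card_le (fun x hx => ?_) ?_
          · exact Finset.mem_sdiff.2 ⟨hsN hx, fun hx' => Finset.disjoint_left.1 hdN hx' hx⟩
          · have := hΛ (m N)
            rw [Finset.card_sdiff_of_subset hφs]; omega
    · rw [hs] at hsN ⊢
      refine ⟨Function.update φ (m N + 1) (ψ (u (N + 1))), fun j hj => ?_, fun j hj => ?_,
        fun i hi => ?_⟩
      · by_cases hj' : j = m N + 1
        · subst hj'; simpa using ⟨hsN, hcN⟩
        · rw [Function.update_of_ne hj']; exact h1 j (by omega)
      · rw [Function.update_of_ne (by omega : j ≠ m N + 1)]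
        by_cases hj' : j = m N
        · subst hj'
          rw [Function.update_self, ← h3e hpar]; exact hdN
        · rw [Function.update_of_ne (by omega : j + 1 ≠ m N + 1)]; exact h2 j (by omega)
      · rcases (by omega : i ≤ N ∨ i = N + 1) with hi' | rfl
        · obtain ⟨a, b, c⟩ := h3 i hi'
          rw [Function.update_of_ne (by omega : m i ≠ m N + 1)]
          exact ⟨by omega, b, c⟩
        · rw [hs, Function.update_self]
          refine ⟨le_rfl, fun _ => rfl, fun h => by omega⟩

/-- A cycle of length `n`, given by a periodic sequence of vertices. -/
structure IsCyc {V : Type*} (G : SimpleGraph V) (n : ℕ) (u : ℕ → V) : Prop where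
  three_le : 3 ≤ n
  per : ∀ i, u (i + n) = u i
  adj : ∀ i, G.Adj (u i) (u (i + 1))
  inj : ∀ i j, i < n → j < n → u i = u j → i = j

/-- A choosable graph containing a cycle and further vertices `x 0, …` off the cycle has a
coloring of a graph formed by shortening arcs of the cycle. -/
theorem IsCyc.exists_collapse {V : Type*} {G : SimpleGraph V} (hG : G.IsChoosable 4 2) {n : ℕ}
    {u : ℕ → V} (hu : G.IsCyc n u) (m : ℕ → ℕ) (h0 : m 0 = 0)
    (hm : ∀ i < n, m (i + 1) = m i ∨ (m (i + 1) = m i + 1 ∧ (i + m i) % 2 = 0))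
    (hn : (n + m n) % 2 = 0) (Λ : ℕ → Finset ℕ)
    (hΛ : ∀ j, (Λ j).card = 4) (hw : Λ (m n) = Λ 0) (Lo : V → Finset ℕ)
    (hLo : ∀ v, (Lo v).card = 4) :
    ∃ (φ : ℕ → Finset ℕ) (ψ : V → Finset ℕ), (∀ j ≤ m n, φ j ⊆ Λ j ∧ (φ j).card = 2) ∧
      (∀ j < m n, Disjoint (φ j) (φ (j + 1))) ∧ φ (m n) = φ 0 ∧
      (∀ i ≤ n, (i + m i) % 2 = 0 → ψ (u i) = φ (m i)) ∧
      (∀ v w, G.Adj v w → Disjoint (ψ v) (ψ w)) ∧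
      (∀ v, (∀ i < n, u i ≠ v) → ψ v ⊆ Lo v) ∧ ∀ v, (ψ v).card = 2 := by
  classical
  let L : V → Finset ℕ := fun v => if h : ∃ i < n, u i = v then Λ (m h.choose) else Lo v
  have hL : ∀ i < n, L (u i) = Λ (m i) := by
    intro i hi
    have h : ∃ k < n, u k = u i := ⟨i, hi, rfl⟩
    have e : h.choose = i := hu.inj _ _ h.choose_spec.1 hi h.choose_spec.2
    simp only [L, dif_pos h, e]
  have hL' : ∀ i ≤ n, L (u i) = Λ (m i) := by
    intro i hi
    rcases Nat.lt_or_eq_of_le hi with hi | rfl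
    · exact hL i hi
    · have h3 := hu.three_le
      have h1 : u i = u 0 := by simpa using hu.per 0
      rw [h1, hL 0 (by omega), h0, hw]
  obtain ⟨ψ, hψ, hd⟩ := hG L (by
    intro v
    by_cases h : ∃ i < n, u i = v
    · simp only [L, dif_pos h, hΛ]
    · simp only [L, dif_neg h, hLo])
  obtain ⟨φ, h1, h2, h3⟩ := SimpleGraph.exists_collapse u m n Λ hΛ ψ h0 hm
    (fun i hi => by rw [← hL' i hi]; exact hψ _) (fun i _ => hd _ _ (hu.adj i))
  refine ⟨φ, ψ, h1, h2, ?_, h3, hd, ?_, fun v => (hψ v).2⟩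
  · have a := h3 n le_rfl hn
    have b := h3 0 (by omega) (by omega)
    have c : u n = u 0 := by simpa using hu.per 0
    rw [h0] at b
    rw [← a, ← b, c]
  · intro v hv
    have h : ¬ ∃ i < n, u i = v := by simpa using hv
    have := (hψ v).1
    simpa only [L, dif_neg h] using this

/-- The search instance of a cycle with lists `lst`, with vertices off the cycle with lists `outs`,
with chords `ch` and edges `oe` from the vertices off the cycle to the cycle. -/
def cycInst (lst outs : List (List ℕ)) (ch oe : List (ℕ × ℕ)) : List (List ℕ × List ℕ) :=
  (lst.zipIdx.map fun p => (p.1, (if p.2 = 0 then [] else [p.2 - 1]) ++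
    (if p.2 + 1 = lst.length ∧ p.2 ≠ 0 then [0] else []) ++
    (ch.filter fun e => decide (e.2 = p.2 ∧ e.1 < e.2)).map Prod.fst)) ++
  (outs.zipIdx.map fun p => (p.1, (oe.filter fun e => decide (e.1 = p.2 ∧ e.2 < lst.length)).map
    Prod.snd))

theorem IsCyc.false_of_search {V : Type*} {G : SimpleGraph V} (hG : G.IsChoosable 4 2) {n : ℕ}
    {u : ℕ → V} (hu : G.IsCyc n u) (m : ℕ → ℕ) (lst outs : List (List ℕ)) (ch oe : List (ℕ × ℕ))
    (hs : search (cycInst lst outs ch oe) [] = false)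
    (hl : ∀ l ∈ lst ++ outs, l.toFinset.card = 4)
    (h0 : m 0 = 0) (hmn : m n = lst.length)
    (hm : ∀ i < n, m (i + 1) = m i ∨ (m (i + 1) = m i + 1 ∧ (i + m i) % 2 = 0))
    (hn : (n + m n) % 2 = 0) (hpos : 0 < lst.length)
    (hch : ∀ e ∈ ch, ∃ i ≤ n, ∃ i' ≤ n, G.Adj (u i) (u i') ∧
      (m i = e.1 ∨ m i = lst.length ∧ e.1 = 0) ∧ (m i' = e.2 ∨ m i' = lst.length ∧ e.2 = 0) ∧
      (i + m i) % 2 = 0 ∧ (i' + m i') % 2 = 0)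
    (x : ℕ → V) (hx : ∀ s < outs.length, ∀ t < outs.length, x s = x t → s = t)
    (hxu : ∀ t < outs.length, ∀ i < n, u i ≠ x t)
    (hoe : ∀ e ∈ oe, ∃ i ≤ n, G.Adj (x e.1) (u i) ∧
      (m i = e.2 ∨ m i = lst.length ∧ e.2 = 0) ∧ (i + m i) % 2 = 0) : False := by
  classical
  -- `l0` is a default list of four colors for the vertices that take no part in the configuration.
  obtain ⟨l0, hl0⟩ : ∃ l0, l0 ∈ lst := ⟨lst[0], List.getElem_mem hpos⟩
  have hl0c : l0.toFinset.card = 4 := hl l0 (by simp [hl0])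
  let Λ : ℕ → Finset ℕ := fun j => (lst.getD (j % lst.length) []).toFinset
  have hΛ : ∀ j, (Λ j).card = 4 := by
    intro j
    have hj := Nat.mod_lt j hpos
    simp only [Λ, List.getD_eq_getElem _ _ hj]
    exact hl _ (List.mem_append_left _ (List.getElem_mem hj))
  let Lo : V → Finset ℕ := fun v =>
    if h : ∃ t < outs.length, x t = v then (outs.getD h.choose []).toFinset else l0.toFinset
  have hLo' : ∀ t < outs.length, Lo (x t) = (outs.getD t []).toFinset := by
    intro t ht
    have h : ∃ k < outs.length, x k = x t := ⟨t, ht, rfl⟩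
    have e : h.choose = t := hx _ h.choose_spec.1 _ ht h.choose_spec.2
    simp only [Lo, dif_pos h, e]
  have hLo : ∀ v, (Lo v).card = 4 := by
    intro v
    by_cases h : ∃ t < outs.length, x t = v
    · obtain ⟨t, ht, rfl⟩ := h
      rw [hLo' t ht, List.getD_eq_getElem _ _ ht]
      exact hl _ (List.mem_append_right _ (List.getElem_mem ht))
    · simp only [Lo, dif_neg h, hl0c]
  obtain ⟨φ, ψ, a1, a2, a3, a4, a5, a6, a7⟩ :=
    hu.exists_collapse hG m h0 hm hn Λ hΛ (by simp [Λ, hmn]) Lo hLo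
  rw [hmn] at a1 a2 a3
  -- Position `n` is the same vertex as position 0, so its image `lst.length` stands for index 0 of
  -- the short cycle.
  have wrap : ∀ {a b : ℕ}, (a = b ∨ a = lst.length ∧ b = 0) → φ a = φ b := by
    rintro a b (rfl | ⟨rfl, rfl⟩)
    · rfl
    · exact a3
  have key : ∀ i i', i < lst.length → i' < lst.length → (i, i') ∈ ch → Disjoint (φ i) (φ i') := by
    intro i i' _ _ h
    obtain ⟨p, hp, q, hq, hadj, hp', hq', e1, e2⟩ := hch _ h
    have := a5 _ _ hadj
    rwa [a4 p hp e1, a4 q hq e2, wrap hp', wrap hq'] at this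
  let c : ℕ → Finset ℕ := fun j => if j < lst.length then φ j else ψ (x (j - lst.length))
  have hc1 : ∀ j < lst.length, c j = φ j := fun j hj => if_pos hj
  have hc2 : ∀ t, c (lst.length + t) = ψ (x t) := fun t => by simp [c]
  have hlen : (cycInst lst outs ch oe).length = lst.length + outs.length := by simp [cycInst]
  have := search_of_coloring c (cycInst lst outs ch oe) [] (by simp) ?_ ?_
  · rw [hs] at this; cases this
  · intro i hi
    rw [hlen] at hi
    simp only [List.length_nil, zero_add]
    by_cases hi' : i < lst.length
    · have hg : (cycInst lst outs ch oe)[i].1 = lst[i] := by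
        simp [cycInst, hi']
      rw [hg, hc1 i hi']
      have := a1 i hi'.le
      simpa [Λ, Nat.mod_eq_of_lt hi', hi'] using this
    · obtain ⟨t, rfl⟩ := Nat.exists_eq_add_of_le (not_lt.1 hi')
      have ht : t < outs.length := by omega
      have hg : (cycInst lst outs ch oe)[lst.length + t].1 = outs[t] := by
        simp [cycInst]
      rw [hg, hc2]
      have := a6 (x t) (hxu t ht)
      rw [hLo' t ht, List.getD_eq_getElem _ _ ht] at this
      exact ⟨this, a7 _⟩
  · intro i hi k hk
    rw [hlen] at hi
    simp only [List.length_nil, zero_add]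
    by_cases hi' : i < lst.length
    · simp only [cycInst, List.getElem_append, List.length_map, List.length_zipIdx, hi', dite_true,
        List.getElem_map, List.getElem_zipIdx, List.mem_append, List.mem_map, List.mem_filter,
        decide_eq_true_eq, Prod.exists, exists_and_right, exists_eq_right, zero_add] at hk
      rcases hk with (hk | hk) | ⟨b, hk, rfl, hlt⟩
      · split_ifs at hk with h
        · simp at hk
        · have hk' : k = i - 1 := by simpa using hk
          subst hk'
          refine ⟨by omega, ?_⟩
          have := a2 (i - 1) (by omega)
          rw [show i - 1 + 1 = i by omega] at this
          rw [hc1 _ hi', hc1 _ (by omega)]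
          exact this.symm
      · split_ifs at hk with h
        · have hk' : k = 0 := by simpa using hk
          subst hk'
          refine ⟨by omega, ?_⟩
          have := a2 i hi'
          rw [h.1, a3] at this
          rwa [hc1 _ hi', hc1 _ (by omega)]
        · simp at hk
      · refine ⟨hlt, ?_⟩
        rw [hc1 _ hi', hc1 _ (by omega)]
        exact (key _ _ (by omega) hi' hk).symm
    · obtain ⟨t, rfl⟩ := Nat.exists_eq_add_of_le (not_lt.1 hi')
      have ht : t < outs.length := by omega
      simp only [cycInst, List.getElem_append, List.length_map, List.length_zipIdx, hi', dite_false,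
        List.getElem_map, List.getElem_zipIdx, List.mem_map, List.mem_filter,
        decide_eq_true_eq, Prod.exists, exists_eq_right, zero_add, add_tsub_cancel_left] at hk
      obtain ⟨b, hk, rfl, hlt⟩ := hk
      refine ⟨by omega, ?_⟩
      obtain ⟨p, hp, hadj, hp', e1⟩ := hoe _ hk
      have := a5 _ _ hadj
      rw [a4 p hp e1, wrap hp'] at this
      rwa [hc2, hc1 _ hlt]

/-- The positions of four points that divide a cycle into arcs. -/
def arcPos (s₁ s₂ s₃ : ℕ) : ℕ → ℕ
  | 0 => 0
  | 1 => s₁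
  | 2 => s₂
  | _ => s₃

/-- A cycle divided into four arcs, with chords and further vertices attached to the dividing
points, admits no bad list assignment after the arcs are shortened to `l₁, …, l₄`. -/
theorem IsCyc.false_of_arcs {V : Type*} {G : SimpleGraph V} (hG : G.IsChoosable 4 2) {n : ℕ}
    {u : ℕ → V} (hu : G.IsCyc n u) {s₁ s₂ s₃ : ℕ} (l₁ l₂ l₃ l₄ : ℕ)
    (lst outs : List (List ℕ)) (ch oe : List (ℕ × ℕ))
    (hs : search (cycInst lst outs
      ((ch ++ ch.map Prod.swap).map fun e =>
        (arcPos l₁ (l₁ + l₂) (l₁ + l₂ + l₃) e.1 % lst.length,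
          arcPos l₁ (l₁ + l₂) (l₁ + l₂ + l₃) e.2 % lst.length))
      (oe.map fun e => (e.1, arcPos l₁ (l₁ + l₂) (l₁ + l₂ + l₃) e.2 % lst.length))) [] = false)
    (hl : (∀ l ∈ lst ++ outs, l.toFinset.card = 4) ∧ lst.length = l₁ + l₂ + l₃ + l₄)
    (ha : (l₁ ≤ s₁ ∧ s₁ + l₂ ≤ s₂ ∧ s₂ + l₃ ≤ s₃ ∧ s₃ + l₄ ≤ n) ∧ (s₁ + l₁) % 2 = 0 ∧
      (s₁ + s₂ + l₂) % 2 = 0 ∧ (s₂ + s₃ + l₃) % 2 = 0 ∧ (s₃ + n + l₄) % 2 = 0)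
    (hch : ∀ e ∈ ch, G.Adj (u (arcPos s₁ s₂ s₃ e.1)) (u (arcPos s₁ s₂ s₃ e.2)))
    (x : ℕ → V) (hx : ∀ s < outs.length, ∀ t < outs.length, x s = x t → s = t)
    (hxu : ∀ t < outs.length, ∀ i < n, u i ≠ x t)
    (hoe : ∀ e ∈ oe, G.Adj (x e.1) (u (arcPos s₁ s₂ s₃ e.2)))
    (hpos : 0 < l₁ + l₂ + l₃ + l₄) : False := by
  obtain ⟨hl, hlen⟩ := hl
  obtain ⟨⟨b1, b2, b3, b4⟩, p1, p2, p3, p4⟩ := ha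
  -- On the k-th arc `m` advances along the first lₖ edges and then rests. The surplus is even, so
  -- each dividing point carries the set of its image. With lₖ = 0 an arc of even length contracts
  -- to a point.
  let m : ℕ → ℕ := fun i => min i l₁ + min (i - s₁) l₂ + min (i - s₂) l₃ + min (i - s₃) l₄
  have lo : ∀ {i s l : ℕ}, i ≤ s → min (i - s) l = 0 := by intro i s l h; omega
  have hi : ∀ {i s l : ℕ}, s + l ≤ i → min (i - s) l = l := by intro i s l h; omega
  have m1 : ∀ i ≤ s₁, m i = min i l₁ := fun i h => by
    simp only [m, lo h, lo (by omega : i ≤ s₂), lo (by omega : i ≤ s₃), add_zero]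
  have m2 : ∀ i, s₁ ≤ i → i ≤ s₂ → m i = l₁ + min (i - s₁) l₂ := fun i h h' => by
    simp only [m, lo h', lo (by omega : i ≤ s₃), add_zero, min_eq_right (b1.trans h)]
  have m3 : ∀ i, s₂ ≤ i → i ≤ s₃ → m i = l₁ + l₂ + min (i - s₂) l₃ := fun i h h' => by
    simp only [m, lo h', add_zero, min_eq_right (by omega : l₁ ≤ i), hi (by omega : s₁ + l₂ ≤ i)]
  have m4 : ∀ i, s₃ ≤ i → m i = l₁ + l₂ + l₃ + min (i - s₃) l₄ := fun i h => by
    simp only [m, min_eq_right (by omega : l₁ ≤ i), hi (by omega : s₁ + l₂ ≤ i),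
      hi (by omega : s₂ + l₃ ≤ i)]
  have m0 : m 0 = 0 := by rw [m1 0 (by omega)]; omega
  have mn : m n = lst.length := by rw [m4 n (by omega)]; omega
  have hstep : ∀ i < n, m (i + 1) = m i ∨ (m (i + 1) = m i + 1 ∧ (i + m i) % 2 = 0) := by
    intro i _
    rcases lt_or_ge i s₁ with h | h
    · rw [m1 i h.le, m1 _ h]; omega
    rcases lt_or_ge i s₂ with h' | h'
    · rw [m2 i h h'.le, m2 _ (by omega) h']; omega
    rcases lt_or_ge i s₃ with h'' | h''
    · rw [m3 i h' h''.le, m3 _ (by omega) h'']; omega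
    · rw [m4 i h'', m4 _ (by omega)]; omega
  have hle : ∀ k, arcPos s₁ s₂ s₃ k ≤ n := by
    intro k
    rcases k with _ | _ | _ | k <;> simp only [arcPos] <;> omega
  have hm : ∀ k, (m (arcPos s₁ s₂ s₃ k) = arcPos l₁ (l₁ + l₂) (l₁ + l₂ + l₃) k % lst.length ∨
      m (arcPos s₁ s₂ s₃ k) = lst.length ∧
        arcPos l₁ (l₁ + l₂) (l₁ + l₂ + l₃) k % lst.length = 0) ∧
      (arcPos s₁ s₂ s₃ k + m (arcPos s₁ s₂ s₃ k)) % 2 = 0 := by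
    intro k
    have e : m (arcPos s₁ s₂ s₃ k) = arcPos l₁ (l₁ + l₂) (l₁ + l₂ + l₃) k := by
      rcases k with _ | _ | _ | k <;> simp only [arcPos, zero_add, Nat.reduceAdd]
      · exact m0
      · rw [m1 _ le_rfl]; omega
      · rw [m2 _ (by omega) le_rfl]; omega
      · rw [m3 _ (by omega) le_rfl]; omega
    have hb : arcPos l₁ (l₁ + l₂) (l₁ + l₂ + l₃) k ≤ lst.length := by
      rcases k with _ | _ | _ | k <;> simp only [arcPos] <;> omega
    rw [e]
    refine ⟨?_, by rcases k with _ | _ | _ | k <;> simp only [arcPos] <;> omega⟩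
    rcases Nat.lt_or_eq_of_le hb with h | h
    · exact Or.inl (Nat.mod_eq_of_lt h).symm
    · exact Or.inr ⟨h, by rw [h, Nat.mod_self]⟩
  refine hu.false_of_search hG m lst outs _ _ hs hl m0 mn hstep (by omega) (by omega) ?_ x hx hxu ?_
  · intro e he
    obtain ⟨f, hf, rfl⟩ := List.mem_map.1 he
    refine ⟨_, hle f.1, _, hle f.2, ?_, (hm _).1, (hm _).1, (hm _).2, (hm _).2⟩
    -- Reversed chords were added because reduction modulo `lst.length` can change the order of the
    -- ends, while `cycInst` keeps only pairs with the smaller index first.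
    rcases List.mem_append.1 hf with hf | hf
    · exact hch _ hf
    · obtain ⟨g, hg, rfl⟩ := List.mem_map.1 hf
      exact (hch _ hg).symm
  · intro e he
    obtain ⟨f, hf, rfl⟩ := List.mem_map.1 he
    exact ⟨_, hle f.2, hoe _ hf, (hm _).1, (hm _).2⟩

/-! ### Forbidden configurations on a cycle -/

variable {V : Type*} {G : SimpleGraph V} {n : ℕ} {u : ℕ → V}

/-- The arcs shorten to lengths 3, 1, 3, 1 if the gaps between the chords are odd, and otherwise to
3, 2, 3, 0 or 3, 0, 3, 2. Both gaps vanish only for two copies of the same chord, which `hne` rules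
out. -/
theorem IsCyc.false_of_noncrossing_chords (hG : G.IsChoosable 4 2) (hu : G.IsCyc n u) {a p q : ℕ}
    (h₁ : G.Adj (u 0) (u a)) (h₂ : G.Adj (u p) (u q)) (ha : 3 ≤ a) (hap : a ≤ p) (hpq : p + 3 ≤ q)
    (hq : q ≤ n) (ha' : a % 2 = 1) (hpq' : (p + q) % 2 = 1) (hn : n % 2 = 0)
    (hne : ¬ (p = a ∧ q = n)) : False := by
  have hch : ∀ e ∈ ([(0, 1), (2, 3)] : List (ℕ × ℕ)), G.Adj (u (arcPos a p q e.1)) (u (arcPos a p q e.2)) := by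
    simpa [arcPos] using ⟨h₁, h₂⟩
  have hoe : ∀ e ∈ ([] : List (ℕ × ℕ)), G.Adj ((fun _ => u 0) e.1) (u (arcPos a p q e.2)) := by simp
  by_cases h0 : (p - a) % 2 = 1
  · exact hu.false_of_arcs hG (s₁ := a) (s₂ := p) (s₃ := q) 3 1 3 1
      [[0, 1, 2, 4], [0, 2, 4, 5], [1, 2, 3, 5], [1, 2, 3, 4], [0, 2, 3, 4], [0, 2, 3, 5],
      [1, 2, 4, 5], [0, 1, 2, 4]]
      [] [(0, 1), (2, 3)] []
      (by decide +kernel) (by decide) (by omega)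
      hch (fun _ => u 0) (by simp) (by simp) hoe (by omega)
  by_cases h1 : a + 2 ≤ p
  · exact hu.false_of_arcs hG (s₁ := a) (s₂ := p) (s₃ := q) 3 2 3 0
      [[0, 1, 3, 5], [0, 1, 3, 5], [0, 1, 2, 3], [0, 1, 2, 5], [0, 2, 4, 5], [0, 1, 3, 4],
      [0, 1, 2, 4], [0, 2, 3, 5]]
      [] [(0, 1), (2, 3)] []
      (by decide +kernel) (by decide) (by omega)
      hch (fun _ => u 0) (by simp) (by simp) hoe (by omega)
  exact hu.false_of_arcs hG (s₁ := a) (s₂ := p) (s₃ := q) 3 0 3 2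
    [[1, 2, 3, 5], [1, 3, 4, 5], [0, 2, 3, 4], [0, 1, 2, 3], [0, 1, 2, 5], [0, 3, 4, 5],
    [0, 1, 3, 4], [1, 2, 4, 5]]
    [] [(0, 1), (2, 3)] []
    (by decide +kernel) (by decide) (by omega)
    hch (fun _ => u 0) (by simp) (by simp) hoe (by omega)

/-- The four arcs alternate in parity. There are bad lists as soon as an odd arc has length at least
3 (shorten to 3, 2, 1, 2 up to rotation) or both even arcs have length at least 4 (shorten to 1, 4,
1, 4). What is left has odd arcs of length 1 and an even arc of length 2. -/
theorem IsCyc.crossing_chords (hG : G.IsChoosable 4 2) (hu : G.IsCyc n u) {j k l : ℕ}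
    (h₁ : G.Adj (u 0) (u j)) (h₂ : G.Adj (u k) (u l)) (hk : 0 < k) (hkj : k < j) (hjl : j < l)
    (hl : l < n) (hj' : j % 2 = 1) (hkl' : (k + l) % 2 = 1) (hn : n % 2 = 0) :
    (k = 1 ∧ l = j + 1 ∧ (j = 3 ∨ n = l + 2)) ∨ (j = k + 1 ∧ n = l + 1 ∧ (k = 2 ∨ l = j + 2)) := by
  by_contra hcon
  have hch : ∀ e ∈ ([(0, 2), (1, 3)] : List (ℕ × ℕ)), G.Adj (u (arcPos k j l e.1)) (u (arcPos k j l e.2)) := by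
    simpa [arcPos] using ⟨h₁, h₂⟩
  have hoe : ∀ e ∈ ([] : List (ℕ × ℕ)), G.Adj ((fun _ => u 0) e.1) (u (arcPos k j l e.2)) := by simp
  by_cases h0 : k % 2 = 1 ∧ 3 ≤ k
  · exact hu.false_of_arcs hG (s₁ := k) (s₂ := j) (s₃ := l) 3 2 1 2
      [[1, 2, 3, 5], [0, 2, 3, 5], [0, 1, 3, 4], [1, 2, 3, 4], [0, 1, 2, 3], [0, 1, 3, 5],
      [0, 3, 4, 5], [0, 2, 3, 4]]
      [] [(0, 2), (1, 3)] []
      (by decide +kernel) (by decide) (by omega)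
      hch (fun _ => u 0) (by simp) (by simp) hoe (by omega)
  by_cases h1 : k % 2 = 1 ∧ j + 3 ≤ l
  · exact hu.false_of_arcs hG (s₁ := k) (s₂ := j) (s₃ := l) 1 2 3 2
      [[0, 2, 3, 4], [0, 1, 2, 4], [1, 2, 4, 5], [0, 2, 3, 5], [0, 1, 3, 5], [1, 2, 3, 5],
      [0, 1, 2, 5], [0, 3, 4, 5]]
      [] [(0, 2), (1, 3)] []
      (by decide +kernel) (by decide) (by omega)
      hch (fun _ => u 0) (by simp) (by simp) hoe (by omega)
  by_cases h2 : k % 2 = 1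
  · exact hu.false_of_arcs hG (s₁ := k) (s₂ := j) (s₃ := l) 1 4 1 4
      [[1, 3, 4, 5], [0, 2, 4, 5], [0, 3, 4, 5], [1, 3, 4, 5], [0, 1, 3, 4], [0, 1, 3, 5],
      [0, 1, 2, 5], [0, 1, 2, 4], [0, 3, 4, 5], [1, 3, 4, 5]]
      [] [(0, 2), (1, 3)] []
      (by decide +kernel) (by decide) (by omega)
      hch (fun _ => u 0) (by simp) (by simp) hoe (by omega)
  by_cases h3 : k + 3 ≤ j
  · exact hu.false_of_arcs hG (s₁ := k) (s₂ := j) (s₃ := l) 2 3 2 1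
      [[0, 2, 4, 5], [2, 3, 4, 5], [1, 2, 3, 4], [1, 2, 3, 5], [0, 3, 4, 5], [0, 2, 3, 4],
      [0, 1, 3, 5], [0, 1, 4, 5]]
      [] [(0, 2), (1, 3)] []
      (by decide +kernel) (by decide) (by omega)
      hch (fun _ => u 0) (by simp) (by simp) hoe (by omega)
  by_cases h4 : l + 3 ≤ n
  · exact hu.false_of_arcs hG (s₁ := k) (s₂ := j) (s₃ := l) 2 1 2 3
      [[1, 2, 3, 4], [0, 1, 2, 4], [0, 2, 3, 5], [1, 2, 3, 5], [0, 1, 3, 4], [0, 2, 3, 4],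
      [1, 2, 4, 5], [1, 3, 4, 5]]
      [] [(0, 2), (1, 3)] []
      (by decide +kernel) (by decide) (by omega)
      hch (fun _ => u 0) (by simp) (by simp) hoe (by omega)
  exact hu.false_of_arcs hG (s₁ := k) (s₂ := j) (s₃ := l) 4 1 4 1
    [[0, 1, 2, 4], [0, 2, 4, 5], [1, 2, 4, 5], [0, 1, 4, 5], [0, 1, 3, 5], [1, 2, 4, 5],
    [1, 2, 4, 5], [0, 1, 4, 5], [0, 2, 3, 5], [0, 1, 2, 3]]
    [] [(0, 2), (1, 3)] []
    (by decide +kernel) (by decide) (by omega)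
    hch (fun _ => u 0) (by simp) (by simp) hoe (by omega)

theorem IsCyc.false_of_chord_of_noncrossing_vertex (hG : G.IsChoosable 4 2) (hu : G.IsCyc n u)
    {v : V} (hv : ∀ i < n, u i ≠ v) {a p q : ℕ} (h₁ : G.Adj (u 0) (u a)) (h₂ : G.Adj v (u p))
    (h₃ : G.Adj v (u q)) (ha : 3 ≤ a) (hap : a ≤ p) (hpq : p < q) (hq : q ≤ n) (ha' : a % 2 = 1)
    (hpq' : (p + q) % 2 = 0) (hn : n % 2 = 0) : False := by
  have hch : ∀ e ∈ ([(0, 1)] : List (ℕ × ℕ)), G.Adj (u (arcPos a p q e.1)) (u (arcPos a p q e.2)) := by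
    simpa [arcPos] using h₁
  have hoe : ∀ e ∈ ([(0, 2), (0, 3)] : List (ℕ × ℕ)), G.Adj ((fun _ => v) e.1) (u (arcPos a p q e.2)) := by
    simpa [arcPos] using ⟨h₂, h₃⟩
  by_cases h0 : (p - a) % 2 = 1
  · exact hu.false_of_arcs hG (s₁ := a) (s₂ := p) (s₃ := q) 3 1 2 0
      [[0, 1, 4, 5], [0, 1, 3, 4], [2, 3, 4, 5], [0, 2, 4, 5], [0, 2, 3, 4], [0, 3, 4, 5]]
      [[1, 2, 3, 4]] [(0, 1)] [(0, 2), (0, 3)]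
      (by decide +kernel) (by decide) (by omega)
      hch (fun _ => v) (by intro s hs t ht; simp at hs ht; omega) (fun _ _ => hv) hoe (by omega)
  exact hu.false_of_arcs hG (s₁ := a) (s₂ := p) (s₃ := q) 3 0 2 1
    [[1, 2, 3, 4], [1, 3, 4, 5], [0, 2, 4, 5], [0, 1, 2, 4], [0, 3, 4, 5], [2, 3, 4, 5]]
    [[1, 2, 4, 5]] [(0, 1)] [(0, 2), (0, 3)]
    (by decide +kernel) (by decide) (by omega)
    hch (fun _ => v) (by intro s hs t ht; simp at hs ht; omega) (fun _ _ => hv) hoe (by omega)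

theorem IsCyc.false_of_chord_of_crossing_vertex (hG : G.IsChoosable 4 2) (hu : G.IsCyc n u)
    {v : V} (hv : ∀ i < n, u i ≠ v) {j k l : ℕ} (h₁ : G.Adj (u 0) (u j)) (h₂ : G.Adj v (u k))
    (h₃ : G.Adj v (u l)) (hk : 0 < k) (hkj : k < j) (hjl : j < l) (hl : l < n) (hj' : j % 2 = 1)
    (hkl' : (k + l) % 2 = 0) (hn : n % 2 = 0) : False := by
  have hch : ∀ e ∈ ([(0, 2)] : List (ℕ × ℕ)), G.Adj (u (arcPos k j l e.1)) (u (arcPos k j l e.2)) := by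
    simpa [arcPos] using h₁
  have hoe : ∀ e ∈ ([(0, 1), (0, 3)] : List (ℕ × ℕ)), G.Adj ((fun _ => v) e.1) (u (arcPos k j l e.2)) := by
    simpa [arcPos] using ⟨h₂, h₃⟩
  by_cases h0 : k % 2 = 1
  · exact hu.false_of_arcs hG (s₁ := k) (s₂ := j) (s₃ := l) 1 2 2 1
      [[0, 1, 2, 5], [0, 1, 2, 3], [2, 3, 5, 6], [0, 2, 5, 6], [1, 2, 4, 6], [1, 2, 4, 5]]
      [[0, 2, 3, 4]] [(0, 2)] [(0, 1), (0, 3)]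
      (by decide +kernel) (by decide) (by omega)
      hch (fun _ => v) (by intro s hs t ht; simp at hs ht; omega) (fun _ _ => hv) hoe (by omega)
  exact hu.false_of_arcs hG (s₁ := k) (s₂ := j) (s₃ := l) 2 1 1 2
    [[0, 3, 5, 6], [1, 2, 3, 6], [0, 1, 2, 3], [0, 2, 3, 5], [2, 3, 4, 5], [0, 3, 4, 6]]
    [[1, 3, 4, 5]] [(0, 2)] [(0, 1), (0, 3)]
    (by decide +kernel) (by decide) (by omega)
    hch (fun _ => v) (by intro s hs t ht; simp at hs ht; omega) (fun _ _ => hv) hoe (by omega)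

/-- If the neighbor pairs differ, the arcs shorten to 2, 1, 2, 1 or 2, 2, 2, 0 or 2, 0, 2, 2. If
they coincide, `6 ≤ n` makes one of the two arcs have length at least 4; on a 4-cycle the
configuration would be θ_{2,2,2,2}, which must be allowed. -/
theorem IsCyc.false_of_noncrossing_vertices (hG : G.IsChoosable 4 2) (hu : G.IsCyc n u)
    {v w : V} (hv : ∀ i < n, u i ≠ v) (hw : ∀ i < n, u i ≠ w) (hvw : v ≠ w) {a p q : ℕ}
    (h₁ : G.Adj v (u 0)) (h₂ : G.Adj v (u a)) (h₃ : G.Adj w (u p)) (h₄ : G.Adj w (u q))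
    (ha : 0 < a) (hap : a ≤ p) (hpq : p < q) (hq : q ≤ n) (ha' : a % 2 = 0)
    (hpq' : (p + q) % 2 = 0) (hn : n % 2 = 0) (h6 : 6 ≤ n) : False := by
  have hch : ∀ e ∈ ([] : List (ℕ × ℕ)), G.Adj (u (arcPos a p q e.1)) (u (arcPos a p q e.2)) := by simp
  have hoe : ∀ e ∈ ([(0, 0), (0, 1), (1, 2), (1, 3)] : List (ℕ × ℕ)), G.Adj ((fun t => if t = 0 then v else w) e.1) (u (arcPos a p q e.2)) := by
    simpa [arcPos] using ⟨h₁, h₂, h₃, h₄⟩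
  have hx : ∀ s < 2, ∀ t < 2, (if s = 0 then v else w) = (if t = 0 then v else w) → s = t := by
    intro s hs t ht
    split_ifs with a b b
    · omega
    · exact fun h => absurd h hvw
    · exact fun h => absurd h.symm hvw
    · omega
  have hxu : ∀ t < 2, ∀ i < n, u i ≠ if t = 0 then v else w := by
    intro t _ i hi
    split_ifs
    · exact hv i hi
    · exact hw i hi
  by_cases h0 : (p - a) % 2 = 1
  · exact hu.false_of_arcs hG (s₁ := a) (s₂ := p) (s₃ := q) 2 1 2 1
      [[0, 1, 3, 5], [0, 1, 2, 3], [0, 2, 3, 5], [0, 1, 2, 5], [1, 2, 4, 5], [0, 3, 4, 5]]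
      [[1, 2, 3, 5], [0, 1, 2, 4]] [] [(0, 0), (0, 1), (1, 2), (1, 3)]
      (by decide +kernel) (by decide) (by omega)
      hch (fun t => if t = 0 then v else w) hx hxu hoe (by omega)
  by_cases h1 : a + 2 ≤ p
  · exact hu.false_of_arcs hG (s₁ := a) (s₂ := p) (s₃ := q) 2 2 2 0
      [[1, 2, 4, 5], [0, 1, 4, 5], [0, 3, 4, 5], [1, 2, 3, 4], [0, 1, 2, 3], [0, 1, 3, 5]]
      [[0, 2, 3, 5], [0, 2, 4, 5]] [] [(0, 0), (0, 1), (1, 2), (1, 3)]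
      (by decide +kernel) (by decide) (by omega)
      hch (fun t => if t = 0 then v else w) hx hxu hoe (by omega)
  by_cases h2 : q + 2 ≤ n
  · exact hu.false_of_arcs hG (s₁ := a) (s₂ := p) (s₃ := q) 2 0 2 2
      [[1, 2, 3, 5], [1, 3, 4, 5], [0, 1, 3, 4], [0, 1, 3, 5], [0, 2, 4, 5], [0, 2, 3, 4]]
      [[0, 1, 2, 5], [1, 2, 4, 5]] [] [(0, 0), (0, 1), (1, 2), (1, 3)]
      (by decide +kernel) (by decide) (by omega)
      hch (fun t => if t = 0 then v else w) hx hxu hoe (by omega)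
  by_cases h3 : 4 ≤ a
  · exact hu.false_of_arcs hG (s₁ := a) (s₂ := p) (s₃ := q) 4 0 2 0
      [[0, 2, 3, 5], [0, 2, 3, 5], [0, 3, 4, 5], [0, 1, 2, 4], [0, 1, 2, 4], [0, 2, 3, 4]]
      [[0, 2, 4, 5], [0, 1, 3, 5]] [] [(0, 0), (0, 1), (1, 2), (1, 3)]
      (by decide +kernel) (by decide) (by omega)
      hch (fun t => if t = 0 then v else w) hx hxu hoe (by omega)
  exact hu.false_of_arcs hG (s₁ := a) (s₂ := p) (s₃ := q) 2 0 4 0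
    [[0, 1, 3, 4], [0, 1, 2, 3], [0, 1, 2, 5], [1, 2, 4, 5], [2, 3, 4, 5], [0, 1, 3, 4]]
    [[0, 2, 4, 5], [0, 1, 3, 5]] [] [(0, 0), (0, 1), (1, 2), (1, 3)]
    (by decide +kernel) (by decide) (by omega)
    hch (fun t => if t = 0 then v else w) hx hxu hoe (by omega)

/-- The four arcs have the same parity. Even arcs shorten to 2, 2, 2, 2; among odd arcs one has
length at least 3 because `6 ≤ n`, and the others shorten to 1. -/
theorem IsCyc.false_of_crossing_vertices (hG : G.IsChoosable 4 2) (hu : G.IsCyc n u)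
    {v w : V} (hv : ∀ i < n, u i ≠ v) (hw : ∀ i < n, u i ≠ w) (hvw : v ≠ w) {j k l : ℕ}
    (h₁ : G.Adj v (u 0)) (h₂ : G.Adj v (u j)) (h₃ : G.Adj w (u k)) (h₄ : G.Adj w (u l))
    (hk : 0 < k) (hkj : k < j) (hjl : j < l) (hl : l < n) (hj' : j % 2 = 0)
    (hkl' : (k + l) % 2 = 0) (hn : n % 2 = 0) (h6 : 6 ≤ n) : False := by
  have hch : ∀ e ∈ ([] : List (ℕ × ℕ)), G.Adj (u (arcPos k j l e.1)) (u (arcPos k j l e.2)) := by simp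
  have hoe : ∀ e ∈ ([(0, 0), (0, 2), (1, 1), (1, 3)] : List (ℕ × ℕ)), G.Adj ((fun t => if t = 0 then v else w) e.1) (u (arcPos k j l e.2)) := by
    simpa [arcPos] using ⟨h₁, h₂, h₃, h₄⟩
  have hx : ∀ s < 2, ∀ t < 2, (if s = 0 then v else w) = (if t = 0 then v else w) → s = t := by
    intro s hs t ht
    split_ifs with a b b
    · omega
    · exact fun h => absurd h hvw
    · exact fun h => absurd h.symm hvw
    · omega
  have hxu : ∀ t < 2, ∀ i < n, u i ≠ if t = 0 then v else w := by
    intro t _ i hi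
    split_ifs
    · exact hv i hi
    · exact hw i hi
  by_cases h0 : k % 2 = 0
  · exact hu.false_of_arcs hG (s₁ := k) (s₂ := j) (s₃ := l) 2 2 2 2
      [[1, 2, 4, 5], [0, 1, 2, 4], [0, 1, 2, 4], [0, 1, 3, 5], [0, 2, 3, 5], [0, 1, 2, 3],
      [0, 1, 3, 4], [0, 1, 4, 5]]
      [[1, 2, 4, 5], [0, 2, 3, 4]] [] [(0, 0), (0, 2), (1, 1), (1, 3)]
      (by decide +kernel) (by decide) (by omega)
      hch (fun t => if t = 0 then v else w) hx hxu hoe (by omega)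
  by_cases h1 : 3 ≤ k
  · exact hu.false_of_arcs hG (s₁ := k) (s₂ := j) (s₃ := l) 3 1 1 1
      [[0, 1, 3, 4], [0, 3, 4, 5], [2, 3, 4, 5], [0, 2, 3, 4], [0, 2, 3, 5], [0, 1, 3, 5]]
      [[2, 3, 4, 5], [0, 3, 4, 5]] [] [(0, 0), (0, 2), (1, 1), (1, 3)]
      (by decide +kernel) (by decide) (by omega)
      hch (fun t => if t = 0 then v else w) hx hxu hoe (by omega)
  by_cases h2 : k + 3 ≤ j
  · exact hu.false_of_arcs hG (s₁ := k) (s₂ := j) (s₃ := l) 1 3 1 1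
      [[1, 2, 3, 4], [1, 2, 4, 5], [0, 1, 2, 5], [0, 2, 3, 4], [2, 3, 4, 5], [1, 2, 3, 5]]
      [[1, 3, 4, 5], [1, 3, 4, 5]] [] [(0, 0), (0, 2), (1, 1), (1, 3)]
      (by decide +kernel) (by decide) (by omega)
      hch (fun t => if t = 0 then v else w) hx hxu hoe (by omega)
  by_cases h3 : j + 3 ≤ l
  · exact hu.false_of_arcs hG (s₁ := k) (s₂ := j) (s₃ := l) 1 1 3 1
      [[1, 2, 4, 5], [1, 2, 3, 5], [0, 2, 3, 5], [0, 1, 2, 3], [0, 1, 3, 5], [0, 2, 4, 5]]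
      [[0, 1, 4, 5], [0, 1, 2, 4]] [] [(0, 0), (0, 2), (1, 1), (1, 3)]
      (by decide +kernel) (by decide) (by omega)
      hch (fun t => if t = 0 then v else w) hx hxu hoe (by omega)
  exact hu.false_of_arcs hG (s₁ := k) (s₂ := j) (s₃ := l) 1 1 1 3
    [[2, 3, 4, 5], [0, 2, 3, 5], [0, 1, 2, 5], [1, 2, 4, 5], [1, 2, 4, 5], [1, 2, 3, 4]]
    [[0, 2, 4, 5], [0, 2, 3, 4]] [] [(0, 0), (0, 2), (1, 1), (1, 3)]
    (by decide +kernel) (by decide) (by omega)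
    hch (fun t => if t = 0 then v else w) hx hxu hoe (by omega)

theorem IsCyc.false_of_three_neighbors (hG : G.IsChoosable 4 2) (hu : G.IsCyc n u)
    {v : V} (hv : ∀ i < n, u i ≠ v) {a b : ℕ} (h₁ : G.Adj v (u 0)) (h₂ : G.Adj v (u a))
    (h₃ : G.Adj v (u b)) (ha : 0 < a) (hab : a < b) (hb : b < n) (ha' : a % 2 = 0)
    (hb' : b % 2 = 0) (hn : n % 2 = 0) : False := by
  have hch : ∀ e ∈ ([] : List (ℕ × ℕ)), G.Adj (u (arcPos a b n e.1)) (u (arcPos a b n e.2)) := by simp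
  have hoe : ∀ e ∈ ([(0, 0), (0, 1), (0, 2)] : List (ℕ × ℕ)), G.Adj ((fun _ => v) e.1) (u (arcPos a b n e.2)) := by
    simpa [arcPos] using ⟨h₁, h₂, h₃⟩
  exact hu.false_of_arcs hG (s₁ := a) (s₂ := b) (s₃ := n) 2 2 2 0
    [[2, 4, 5, 6], [1, 2, 3, 4], [1, 3, 4, 6], [0, 3, 4, 5], [0, 1, 4, 5], [0, 2, 4, 6]]
    [[1, 4, 5, 6]] [] [(0, 0), (0, 1), (0, 2)]
    (by decide +kernel) (by decide) (by omega)
    hch (fun _ => v) (by intro s hs t ht; simp at hs ht; omega) (fun _ _ => hv) hoe (by omega)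

/-- The configuration contains K_{2,5}, which is refuted directly, with nothing to shorten. -/
theorem IsCyc.false_of_three_vertices (hG : G.IsChoosable 4 2) (hu : G.IsCyc 4 u) (x : ℕ → V)
    (hx : ∀ s < 3, ∀ t < 3, x s = x t → s = t) (hxu : ∀ t < 3, ∀ i < 4, u i ≠ x t)
    (h₀ : ∀ t < 3, G.Adj (x t) (u 0)) (h₂ : ∀ t < 3, G.Adj (x t) (u 2)) : False := by
  refine hu.false_of_search hG id
    [[0, 2, 3, 5], [0, 4, 5, 6], [0, 1, 4, 6], [0, 2, 4, 6]]
    [[0, 1, 3, 4], [0, 1, 3, 6], [0, 1, 2, 5]] []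
    [(0, 0), (0, 2), (1, 0), (1, 2), (2, 0), (2, 2)]
    (by decide +kernel) (by decide) rfl rfl (fun i _ => ?_) (by simp) (by simp) (by simp) x hx hxu ?_
  · right; simp only [id, true_and]; omega
  · simp only [List.forall_mem_cons, List.not_mem_nil, false_imp_iff, implies_true, and_true]
    exact ⟨⟨0, by simp, h₀ 0 (by simp), by simp⟩, ⟨2, by simp, h₂ 0 (by simp), by simp⟩,
      ⟨0, by simp, h₀ 1 (by simp), by simp⟩, ⟨2, by simp, h₂ 1 (by simp), by simp⟩,
      ⟨0, by simp, h₀ 2 (by simp), by simp⟩, ⟨2, by simp, h₂ 2 (by simp), by simp⟩⟩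

/-- A hexagon with its three long diagonals is K_{3,3}. -/
theorem IsCyc.false_of_three_chords (hG : G.IsChoosable 4 2) (hu : G.IsCyc 6 u)
    (h₀ : G.Adj (u 0) (u 3)) (h₁ : G.Adj (u 1) (u 4)) (h₂ : G.Adj (u 2) (u 5)) : False := by
  refine hu.false_of_search hG id
    [[0, 1, 3, 4], [0, 2, 3, 4], [0, 2, 3, 5], [0, 1, 2, 5], [0, 2, 4, 5], [0, 3, 4, 5]]
    [] [(0, 3), (1, 4), (2, 5)] []
    (by decide +kernel) (by decide) rfl rfl (fun i _ => ?_) (by simp) (by simp) ?_ u (by simp)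
    (by simp) (by simp)
  · right; simp only [id, true_and]; omega
  · simp only [List.forall_mem_cons, List.not_mem_nil, false_imp_iff, implies_true, and_true]
    exact ⟨⟨0, by simp, 3, by simp, h₀, by simp⟩, ⟨1, by simp, 4, by simp, h₁, by simp⟩,
      ⟨2, by simp, 5, by simp, h₂, by simp⟩⟩

/-! ### Theta graphs without short paths -/

/-- A theta graph whose three paths have length at least `r`, with the parity of `r`, inherits
colorings of the theta graph whose three paths have length `r`. -/
theorem IsCyc.false_of_long_ear_of_lists (hG : G.IsChoosable 4 2) (hu : G.IsCyc n u) {p : ℕ → V}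
    {ℓ j r : ℕ} (hp0 : p 0 = u 0) (hpl : p ℓ = u j) (hadj : ∀ t < ℓ, G.Adj (p t) (p (t + 1)))
    (hinj : ∀ s t, 0 < s → s < ℓ → 0 < t → t < ℓ → p s = p t → s = t)
    (hout : ∀ t, 0 < t → t < ℓ → ∀ i < n, u i ≠ p t)
    (hr : 0 < r) (hj : r ≤ j) (hjn : j + r ≤ n) (hl : r ≤ ℓ) (hj' : (j + r) % 2 = 0)
    (hl' : (ℓ + r) % 2 = 0) (hn : n % 2 = 0) (Λ Λ' : ℕ → Finset ℕ) (hΛ : ∀ j, (Λ j).card = 4)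
    (hΛ' : ∀ j, (Λ' j).card = 4) (hw : Λ (2 * r) = Λ 0) (h0 : Λ' 0 = Λ 0) (h1 : Λ' r = Λ r)
    (hbad : ∀ φ φ' : ℕ → Finset ℕ, (∀ j ≤ 2 * r, φ j ⊆ Λ j ∧ (φ j).card = 2) →
      (∀ j < 2 * r, Disjoint (φ j) (φ (j + 1))) → φ (2 * r) = φ 0 →
      (∀ j ≤ r, φ' j ⊆ Λ' j ∧ (φ' j).card = 2) → (∀ j < r, Disjoint (φ' j) (φ' (j + 1))) →
      φ' 0 = φ 0 → φ' r = φ r → False) : False := by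
  classical
  let Lo : V → Finset ℕ := fun v =>
    if h : ∃ t, (0 < t ∧ t < ℓ) ∧ p t = v then Λ' (min h.choose r) else Λ 0
  have hLo' : ∀ t, 0 < t → t < ℓ → Lo (p t) = Λ' (min t r) := by
    intro t h0 ht
    have h : ∃ k, (0 < k ∧ k < ℓ) ∧ p k = p t := ⟨t, ⟨h0, ht⟩, rfl⟩
    have hs := h.choose_spec
    have e : h.choose = t := hinj _ _ hs.1.1 hs.1.2 h0 ht hs.2
    simp only [Lo, dif_pos h, e]
  have hLo : ∀ v, (Lo v).card = 4 := by
    intro v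
    by_cases h : ∃ t, (0 < t ∧ t < ℓ) ∧ p t = v
    · simp only [Lo, dif_pos h, hΛ']
    · simp only [Lo, dif_neg h, hΛ]
  have hmn : min n r + min (n - j) r = 2 * r := by omega
  obtain ⟨φ, ψ, a1, a2, a3, a4, a5, a6, a7⟩ :=
    hu.exists_collapse hG (fun i => min i r + min (i - j) r) (by simp)
      (by intro i hi; omega) (by omega) Λ hΛ
      (by rw [hmn, hw]) Lo hLo
  simp only [hmn] at a1 a2 a3
  have e0 : ψ (p 0) = φ 0 := by
    have := a4 0 (by omega) (by omega)
    rw [hp0]; simpa using this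
  have el : ψ (p ℓ) = φ r := by
    have := a4 j (by omega) (by omega)
    rw [hpl, this]
    congr 1
    omega
  -- The same coloring `ψ` is now shortened along the ear. Both shortenings keep the sets at the two
  -- branch vertices, so `φ` and `φ'` agree there and color the theta graph with three paths of
  -- length `r`.
  obtain ⟨φ', b1, b2, b3⟩ := SimpleGraph.exists_collapse p (fun t => min t r) ℓ Λ' hΛ' ψ (by simp)
    (by intro i hi; omega) (by
      intro t ht
      refine ⟨?_, a7 _⟩
      rcases Nat.eq_zero_or_pos t with rfl | h
      · simp only [zero_min]
        rw [e0, h0]; exact (a1 0 (by omega)).1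
      · rcases Nat.lt_or_eq_of_le ht with h' | rfl
        · rw [← hLo' t h h']; exact a6 _ (hout t h h')
        · simp only [min_eq_right hl]
          rw [el, h1]; exact (a1 r (by omega)).1) (fun t ht => a5 _ _ (hadj t ht))
  simp only [min_eq_right hl] at b1 b2
  refine hbad φ φ' a1 a2 a3 b1 b2 ?_ ?_
  · have := b3 0 (by omega) (by simp)
    rw [← e0, this]; simp
  · have := b3 ℓ le_rfl (by omega)
    rw [← el, this]
    congr 1; omega

/-- Every theta subgraph of a `(4, 2)`-choosable graph has a path of length at most two. -/
theorem IsCyc.false_of_long_ear (hG : G.IsChoosable 4 2) (hu : G.IsCyc n u) {p : ℕ → V}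
    {ℓ j : ℕ} (hp0 : p 0 = u 0) (hpl : p ℓ = u j) (hadj : ∀ t < ℓ, G.Adj (p t) (p (t + 1)))
    (hinj : ∀ s t, 0 < s → s < ℓ → 0 < t → t < ℓ → p s = p t → s = t)
    (hout : ∀ t, 0 < t → t < ℓ → ∀ i < n, u i ≠ p t)
    (hj : 3 ≤ j) (hjn : j + 3 ≤ n) (hl : 3 ≤ ℓ) (hl' : (ℓ + j) % 2 = 0) (hn : n % 2 = 0) :
    False := by
  -- The three lengths have the same parity and are at least 3: even ones shorten to 4, odd ones to
  -- 3.
  rcases Nat.mod_two_eq_zero_or_one j with hj' | hj'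
  · refine hu.false_of_long_ear_of_lists hG (r := 4) hp0 hpl hadj hinj hout (by omega) (by omega)
      (by omega) (by omega) (by omega) (by omega) hn
      (fun i => ([[0, 1, 2, 4], [0, 1, 2, 4], [0, 1, 3, 4], [0, 2, 3, 4], [0, 1, 2, 4],
        [0, 1, 3, 4], [0, 1, 2, 3], [0, 1, 2, 4]].getD (i % 8) []).toFinset)
      (fun i => ([[0, 1, 2, 4], [0, 1, 2, 4], [0, 2, 3, 4], [0, 1, 2, 3]].getD (i % 4) []).toFinset)
      ?_ ?_ rfl rfl rfl ?_
    · intro j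
      have hlt := Nat.mod_lt j (by omega : 8 > 0)
      generalize j % 8 = i at *
      revert i; decide
    · intro j
      have hlt := Nat.mod_lt j (by omega : 4 > 0)
      generalize j % 4 = i at *
      revert i; decide
    · intro φ φ' a1 a2 a3 b1 b2 b3 b4
      -- Indices 0 to 7 run along the cycle, with branch vertices 0 and 4; indices 8 to 10 are the
      -- interior positions 1 to 3 of the ear.
      have := search_of_coloring (fun i => if i < 8 then φ i else φ' (i - 7))
        [([0, 1, 2, 4], []), ([0, 1, 2, 4], [0]), ([0, 1, 3, 4], [1]), ([0, 2, 3, 4], [2]),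
          ([0, 1, 2, 4], [3]), ([0, 1, 3, 4], [4]), ([0, 1, 2, 3], [5]), ([0, 1, 2, 4], [6, 0]),
          ([0, 1, 2, 4], [0]), ([0, 2, 3, 4], [8]), ([0, 1, 2, 3], [9, 4])] [] (by simp) ?_ ?_
      · revert this; decide +kernel
      · intro i hi
        simp only [List.length_cons, List.length_nil, zero_add, Nat.reduceAdd] at hi ⊢
        interval_cases i
        · exact a1 0 (by omega)
        · exact a1 1 (by omega)
        · exact a1 2 (by omega)
        · exact a1 3 (by omega)
        · exact a1 4 (by omega)
        · exact a1 5 (by omega)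
        · exact a1 6 (by omega)
        · exact a1 7 (by omega)
        · exact b1 1 (by omega)
        · exact b1 2 (by omega)
        · exact b1 3 (by omega)
      · intro i hi
        simp only [List.length_cons, List.length_nil, zero_add, Nat.reduceAdd] at hi ⊢
        have d := fun j hj => (a2 j hj).symm
        have d' := fun j hj => (b2 j hj).symm
        have d7 := a2 7 (by omega)
        have d8 := d' 0 (by omega)
        have d9 := b2 3 (by omega)
        rw [a3] at d7
        rw [b3] at d8
        rw [b4] at d9
        interval_cases i
        · simp
        · simpa using d 0 (by omega)
        · simpa using d 1 (by omega)
        · simpa using d 2 (by omega)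
        · simpa using d 3 (by omega)
        · simpa using d 4 (by omega)
        · simpa using d 5 (by omega)
        · simpa using ⟨d 6 (by omega), d7⟩
        · simpa using d8
        · simpa using d' 1 (by omega)
        · simpa using ⟨d' 2 (by omega), d9⟩
  · refine hu.false_of_long_ear_of_lists hG (r := 3) hp0 hpl hadj hinj hout (by omega) (by omega)
      (by omega) (by omega) (by omega) (by omega) hn
      (fun i => ([[0, 1, 2, 4], [0, 1, 3, 4], [0, 2, 3, 4], [0, 1, 2, 4], [0, 1, 3, 4],
        [0, 1, 2, 3]].getD (i % 6) []).toFinset)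
      (fun i => ([[0, 1, 2, 4], [0, 2, 3, 4], [0, 1, 2, 3]].getD (i % 3) []).toFinset)
      ?_ ?_ rfl rfl rfl ?_
    · intro j
      have hlt := Nat.mod_lt j (by omega : 6 > 0)
      generalize j % 6 = i at *
      revert i; decide
    · intro j
      have hlt := Nat.mod_lt j (by omega : 3 > 0)
      generalize j % 3 = i at *
      revert i; decide
    · intro φ φ' a1 a2 a3 b1 b2 b3 b4
      have := search_of_coloring (fun i => if i < 6 then φ i else φ' (i - 5))
        [([0, 1, 2, 4], []), ([0, 1, 3, 4], [0]), ([0, 2, 3, 4], [1]),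
          ([0, 1, 2, 4], [2]), ([0, 1, 3, 4], [3]), ([0, 1, 2, 3], [4, 0]),
          ([0, 2, 3, 4], [0]), ([0, 1, 2, 3], [6, 3])] [] (by simp) ?_ ?_
      · revert this; decide +kernel
      · intro i hi
        simp only [List.length_cons, List.length_nil, zero_add, Nat.reduceAdd] at hi ⊢
        interval_cases i
        · exact a1 0 (by omega)
        · exact a1 1 (by omega)
        · exact a1 2 (by omega)
        · exact a1 3 (by omega)
        · exact a1 4 (by omega)
        · exact a1 5 (by omega)
        · exact b1 1 (by omega)
        · exact b1 2 (by omega)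
      · intro i hi
        simp only [List.length_cons, List.length_nil, zero_add, Nat.reduceAdd] at hi ⊢
        have d := fun j hj => (a2 j hj).symm
        have d' := fun j hj => (b2 j hj).symm
        have d7 := a2 5 (by omega)
        have d8 := d' 0 (by omega)
        have d9 := b2 2 (by omega)
        rw [a3] at d7
        rw [b3] at d8
        rw [b4] at d9
        interval_cases i
        · simp
        · simpa using d 0 (by omega)
        · simpa using d 1 (by omega)
        · simpa using d 2 (by omega)
        · simpa using d 3 (by omega)
        · simpa using ⟨d 4 (by omega), d7⟩
        · simpa using d8
        · simpa using ⟨d' 1 (by omega), d9⟩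

/-! ### Rotation and parity on cycles -/

theorem IsCyc.mod (hu : G.IsCyc n u) (i : ℕ) : u (i % n) = u i := by
  conv_rhs => rw [← Nat.mod_add_div i n]
  induction i / n with
  | zero => simp
  | succ k ih => rw [ih, Nat.mul_succ, ← add_assoc, hu.per]

theorem IsCyc.rotate (hu : G.IsCyc n u) (k : ℕ) : G.IsCyc n (fun i => u (i + k)) where
  three_le := hu.three_le
  per i := by rw [add_right_comm, hu.per]
  adj i := by rw [add_right_comm]; exact hu.adj _
  inj i j hi hj h := by
    have hpos : 0 < n := by have := hu.three_le; omega
    rw [← hu.mod (i + k), ← hu.mod (j + k)] at h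
    have h' : i + k ≡ j + k [MOD n] := hu.inj _ _ (Nat.mod_lt _ hpos) (Nat.mod_lt _ hpos) h
    exact Nat.ModEq.eq_of_lt_of_lt (Nat.ModEq.add_right_cancel' k h') hi hj

theorem IsCyc.of_path {f : ℕ → V} (hn : 3 ≤ n)
    (hinj : ∀ i j, i < n → j < n → f i = f j → i = j)
    (hadj : ∀ i, i + 1 < n → G.Adj (f i) (f (i + 1))) (hlast : G.Adj (f (n - 1)) (f 0)) :
    G.IsCyc n (fun i => f (i % n)) where
  three_le := hn
  per i := by simp
  adj i := by
    have hlt := Nat.mod_lt i (by omega : n > 0)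
    rcases Nat.lt_or_eq_of_le (Nat.succ_le_of_lt hlt) with h | h
    · have e : (i + 1) % n = i % n + 1 := by
        rw [Nat.add_mod, Nat.mod_eq_of_lt (by omega : 1 < n), Nat.mod_eq_of_lt h]
      rw [e]; exact hadj _ h
    · have e : (i + 1) % n = 0 := by
        rw [Nat.add_mod, Nat.mod_eq_of_lt (by omega : 1 < n), show i % n + 1 = n from h,
          Nat.mod_self]
      rw [e, show i % n = n - 1 by omega]; exact hlast
  inj i j hi hj h := by
    simp only [Nat.mod_eq_of_lt hi, Nat.mod_eq_of_lt hj] at h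
    exact hinj i j hi hj h

/-- A walk whose vertices are listed by a function changes color at every step of a proper
2-coloring. -/
theorem parity_of_walk {c : V → ℕ} (hc : ∀ v w, G.Adj v w → (c v + c w) % 2 = 1) {p : ℕ → V}
    {N : ℕ} (hp : ∀ i < N, G.Adj (p i) (p (i + 1))) : (c (p 0) + c (p N) + N) % 2 = 0 := by
  induction N with
  | zero => omega
  | succ N ih =>
    have h := ih fun i hi => hp i (by omega)
    have h' := hc _ _ (hp N (by omega))
    omega

theorem IsCyc.parity (hu : G.IsCyc n u) {c : V → ℕ}
    (hc : ∀ v w, G.Adj v w → (c v + c w) % 2 = 1) (i : ℕ) : (c (u 0) + c (u i) + i) % 2 = 0 :=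
  parity_of_walk hc fun i _ => hu.adj i

theorem IsCyc.even (hu : G.IsCyc n u) {c : V → ℕ}
    (hc : ∀ v w, G.Adj v w → (c v + c w) % 2 = 1) : n % 2 = 0 := by
  have h := hu.parity hc n
  have e : u n = u 0 := by simpa using hu.per 0
  rw [e] at h
  omega

/-- A `(4, 2)`-choosable graph is bipartite. -/
theorem IsChoosable.exists_parity (hG : G.IsChoosable 4 2) :
    ∃ c : V → ℕ, ∀ v w, G.Adj v w → (c v + c w) % 2 = 1 := by
  classical
  -- With the same four colors everywhere, adjacent sets are complementary, so exactly one end of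
  -- each edge receives color 0.
  obtain ⟨φ, h1, h2⟩ := hG (fun _ => Finset.range 4) (fun _ => by simp)
  refine ⟨fun v => if 0 ∈ φ v then 1 else 0, fun v w hvw => ?_⟩
  have hd := h2 v w hvw
  have hun : φ v ∪ φ w = Finset.range 4 := by
    refine Finset.eq_of_subset_of_card_le (Finset.union_subset (h1 v).1 (h1 w).1) ?_
    rw [Finset.card_union_of_disjoint hd, (h1 v).2, (h1 w).2]; simp
  have h0 : 0 ∈ φ v ∪ φ w := by rw [hun]; simp
  rcases Finset.mem_union.1 h0 with h | h
  · simp [h, Finset.disjoint_left.1 hd h]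
  · simp [h, Finset.disjoint_right.1 hd h]

/-! ### Paths and longest cycles in 2-connected graphs -/

/-- In a 2-connected graph, every vertex is joined to every set by a path that avoids a given
vertex and meets the set only at its end. -/
theorem IsTwoConnected.exists_path (hG : G.IsTwoConnected) {x y s : V} {S : Set V} (hy : y ≠ x)
    (hs : s ∈ S) (hsx : s ≠ x) :
    ∃ (ℓ : ℕ) (p : ℕ → V), p 0 = y ∧ p ℓ ∈ S ∧ (∀ t < ℓ, p t ∉ S) ∧
      (∀ t < ℓ, G.Adj (p t) (p (t + 1))) ∧ (∀ i ≤ ℓ, ∀ j ≤ ℓ, p i = p j → i = j) ∧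
      ∀ t ≤ ℓ, p t ≠ x := by
  classical
  -- A shortest walk to `S` that avoids `x` is taken: stopping at an earlier visit to `S`, or
  -- cutting out a closed part, would shorten it.
  have hex : ∃ ℓ, ∃ p : ℕ → V, p 0 = y ∧ p ℓ ∈ S ∧ (∀ t < ℓ, G.Adj (p t) (p (t + 1))) ∧
      ∀ t ≤ ℓ, p t ≠ x := by
    obtain ⟨W⟩ := not_not.1 (hG.2 x) ⟨y, hy⟩ ⟨s, hsx⟩
    refine ⟨W.length, fun i => (W.getVert i).1, by simp, by simpa using hs, fun t ht => ?_,
      fun t _ => (W.getVert t).2⟩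
    exact W.adj_getVert_succ ht
  obtain ⟨p, h0, h1, h2, h3⟩ := Nat.find_spec hex
  have hmin := fun k => Nat.find_min hex (m := k)
  set ℓ := Nat.find hex
  refine ⟨ℓ, p, h0, h1, fun t ht hS => ?_, h2, ?_, h3⟩
  · exact hmin t ht ⟨p, h0, hS, fun i hi => h2 i (by omega), fun i hi => h3 i (by omega)⟩
  · have key : ∀ i j, i < j → j ≤ ℓ → p i ≠ p j := by
      intro i j hij hj e
      refine hmin (ℓ - (j - i)) (by omega)
        ⟨fun t => if t ≤ i then p t else p (t + (j - i)), by simp [h0], ?_, ?_, ?_⟩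
      · beta_reduce
        by_cases h : ℓ - (j - i) ≤ i
        · have hjl : j = ℓ := by omega
          have : ℓ - (j - i) = i := by omega
          rw [this, if_pos le_rfl, e, hjl]; exact h1
        · rw [if_neg h, show ℓ - (j - i) + (j - i) = ℓ by omega]; exact h1
      · intro t ht
        beta_reduce
        rcases lt_trichotomy t i with h | rfl | h
        · rw [if_pos h.le, if_pos (by omega)]; exact h2 t (by omega)
        · rw [if_pos le_rfl, if_neg (by omega), e, show t + 1 + (j - t) = j + 1 by omega]
          exact h2 j (by omega)
        · rw [if_neg (by omega), if_neg (by omega), add_right_comm]; exact h2 _ (by omega)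
      · intro t ht
        beta_reduce
        split_ifs
        · exact h3 t (by omega)
        · exact h3 _ (by omega)
    intro i hi j hj e
    rcases lt_trichotomy i j with h | h | h
    · exact absurd e (key i j h hj)
    · exact h
    · exact absurd e.symm (key j i h hi)

theorem IsTwoConnected.exists_adj_ne [Fintype V] (hG : G.IsTwoConnected)
    (hcard : 3 ≤ Fintype.card V) {v c : V} (hvc : v ≠ c) : ∃ w, G.Adj v w ∧ w ≠ c := by
  classical
  obtain ⟨z, hz⟩ : ∃ z, z ∉ ({v, c} : Finset V) := by
    by_contra h
    push Not at h
    have : Fintype.card V ≤ ({v, c} : Finset V).card := Finset.card_le_card fun x _ => h x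
    have := Finset.card_le_two (a := v) (b := c)
    omega
  simp only [Finset.mem_insert, Finset.mem_singleton, not_or] at hz
  obtain ⟨ℓ, p, h0, h1, h2, h3, -, h4⟩ :=
    hG.exists_path (S := {z}) hvc (Set.mem_singleton z) hz.2
  have hl : 0 < ℓ := by
    rcases Nat.eq_zero_or_pos ℓ with rfl | h
    · rw [h0] at h1; exact absurd h1.symm hz.1
    · exact h
  exact ⟨p 1, h0 ▸ h3 0 hl, h4 1 hl⟩

theorem IsTwoConnected.exists_two_adj [Fintype V] (hG : G.IsTwoConnected)
    (hcard : 3 ≤ Fintype.card V) (v : V) : ∃ a b, G.Adj v a ∧ G.Adj v b ∧ a ≠ b := by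
  obtain ⟨c, hc⟩ := Fintype.exists_ne_of_one_lt_card (by omega) v
  obtain ⟨a, ha, -⟩ := hG.exists_adj_ne hcard hc.symm
  obtain ⟨b, hb, hba⟩ := hG.exists_adj_ne hcard ha.ne
  exact ⟨a, b, ha, hb, hba.symm⟩

/-- A path between two neighbors of a vertex that avoids this vertex closes up through it. -/
theorem IsTwoConnected.exists_isCyc [Fintype V] (hG : G.IsTwoConnected)
    (hcard : 3 ≤ Fintype.card V) : ∃ n u, G.IsCyc n u := by
  have : Nonempty V := Fintype.card_pos_iff.1 (by omega)
  obtain ⟨v⟩ := this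
  obtain ⟨a, b, ha, hb, hab⟩ := hG.exists_two_adj hcard v
  obtain ⟨ℓ, p, h0, h1, h2, h3, h5, h4⟩ :=
    hG.exists_path (S := {b}) ha.ne.symm (Set.mem_singleton b) hb.ne.symm
  have hl : 0 < ℓ := by
    rcases Nat.eq_zero_or_pos ℓ with rfl | h
    · rw [h0] at h1; exact absurd h1 hab
    · exact h
  refine ⟨ℓ + 2, _, IsCyc.of_path (f := fun t => if t = 0 then v else p (t - 1)) (by omega)
    ?_ ?_ ?_⟩
  · intro i j hi hj e
    beta_reduce at e
    split_ifs at e with e1 e2 e2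
    · omega
    · exact absurd e.symm (h4 _ (by omega))
    · exact absurd e (h4 _ (by omega))
    · have := h5 _ (by omega) _ (by omega) e
      omega
  · intro i hi
    rcases Nat.eq_zero_or_pos i with rfl | h
    · simpa [h0] using ha
    · have := h3 (i - 1) (by omega)
      rw [Nat.sub_add_cancel h] at this
      simpa [h.ne'] using this
  · rw [Set.mem_singleton_iff] at h1
    simpa [h1] using hb.symm

theorem IsCyc.le_card [Fintype V] (hu : G.IsCyc n u) : n ≤ Fintype.card V := by
  simpa using Fintype.card_le_of_injective (fun i : Fin n => u i)
    fun i j h => Fin.ext (hu.inj _ _ i.2 j.2 h)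

theorem IsTwoConnected.exists_longest_cyc [Fintype V] (hG : G.IsTwoConnected)
    (hcard : 3 ≤ Fintype.card V) :
    ∃ n u, G.IsCyc n u ∧ ∀ n' u', G.IsCyc n' u' → n' ≤ n := by
  classical
  obtain ⟨n₀, h₀⟩ := hG.exists_isCyc hcard
  have hb : n₀ ≤ Fintype.card V := h₀.elim fun _ h => h.le_card
  have hs := Nat.findGreatest_spec (P := fun n => ∃ u, G.IsCyc n u) hb h₀
  obtain ⟨u, hu⟩ := hs
  exact ⟨_, u, hu, fun n' u' h' => Nat.le_findGreatest h'.le_card ⟨u', h'⟩⟩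

/-! ### Ears of a longest cycle -/

/-- A path of length at least three with only its ends on a longest cycle is impossible. -/
theorem IsCyc.no_long_ear (hG : G.IsChoosable 4 2) (hu : G.IsCyc n u)
    (hmax : ∀ n' u', G.IsCyc n' u' → n' ≤ n) {p : ℕ → V} {ℓ i j : ℕ} (hi : i < n) (hj : j < n)
    (hij : i ≠ j) (hp0 : p 0 = u i) (hpl : p ℓ = u j) (hadj : ∀ t < ℓ, G.Adj (p t) (p (t + 1)))
    (hinj : ∀ s t, 0 < s → s < ℓ → 0 < t → t < ℓ → p s = p t → s = t)
    (hout : ∀ t, 0 < t → t < ℓ → ∀ i < n, u i ≠ p t) (hl : 3 ≤ ℓ) : False := by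
  obtain ⟨c, hc⟩ := hG.exists_parity
  wlog hi0 : i = 0 generalizing u i j
  · refine this (hu.rotate i) (i := 0) (j := if i < j then j - i else j + n - i) (by omega)
      (by split_ifs <;> omega) (by split_ifs <;> omega) (by simpa using hp0) ?_ ?_ rfl
    · rw [hpl]
      split_ifs with h
      · rw [Nat.sub_add_cancel h.le]
      · rw [Nat.sub_add_cancel (by omega), hu.per]
    · intro t h0 ht k _
      have hn : 0 < n := by omega
      rw [← hu.mod]
      exact hout t h0 ht _ (Nat.mod_lt _ hn)
  subst hi0
  have hj0 : 0 < j := by omega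
  have hn := hu.even hc
  have h0 : u n = u 0 := by simpa using hu.per 0
  -- If the ear is longer than one of the two arcs between its ends, substituting it for that arc
  -- lengthens the cycle. Otherwise all three paths have length at least 3.
  by_cases hjl : j < ℓ
  · have := hmax (ℓ + (n - j)) _ (IsCyc.of_path
      (f := fun t => if t < ℓ then p t else u (j + (t - ℓ))) (by omega) ?_ ?_ ?_)
    · omega
    · have key : ∀ a b, a < ℓ → ℓ ≤ b → b < ℓ + (n - j) → p a ≠ u (j + (b - ℓ)) := by
        intro a b ha hb hb' e
        rcases Nat.eq_zero_or_pos a with rfl | ha0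
        · rw [hp0] at e
          have := hu.inj _ _ (by omega) (by omega) e
          omega
        · exact hout a ha0 ha _ (by omega) e.symm
      have key0 : ∀ a, 0 < a → a < ℓ → p a ≠ p 0 := by
        intro a h0 ha e
        rw [hp0] at e
        exact hout a h0 ha 0 (by omega) e.symm
      intro a b ha hb e
      split_ifs at e with h1 h2 h2
      · rcases Nat.eq_zero_or_pos a with rfl | ha0
        · rcases Nat.eq_zero_or_pos b with rfl | hb0
          · rfl
          · exact absurd e.symm (key0 b hb0 h2)
        · rcases Nat.eq_zero_or_pos b with rfl | hb0
          · exact absurd e (key0 a ha0 h1)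
          · exact hinj _ _ ha0 h1 hb0 h2 e
      · exact absurd e (key a b h1 (by omega) hb)
      · exact absurd e.symm (key b a h2 (by omega) ha)
      · have := hu.inj _ _ (by omega) (by omega) e
        omega
    · intro t ht
      rcases lt_trichotomy (t + 1) ℓ with h | h | h
      · rw [if_pos (by omega), if_pos h]; exact hadj t (by omega)
      · rw [if_pos (by omega), if_neg (by omega)]
        have := hadj t (by omega)
        rw [h, hpl] at this
        simpa [h] using this
      · rw [if_neg (by omega), if_neg (by omega),
          show j + (t + 1 - ℓ) = j + (t - ℓ) + 1 by omega]
        exact hu.adj _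
    · rw [if_neg (by omega), if_pos (by omega), hp0]
      have := hu.adj (n - 1)
      rw [Nat.sub_add_cancel (by omega), h0] at this
      rwa [show j + (ℓ + (n - j) - 1 - ℓ) = n - 1 by omega]
  by_cases hjl' : n - j < ℓ
  · have := hmax (j + ℓ) _ (IsCyc.of_path
      (f := fun t => if t ≤ j then u t else p (ℓ - (t - j))) (by omega) ?_ ?_ ?_)
    · omega
    · intro a b ha hb e
      split_ifs at e with h1 h2 h2
      · exact hu.inj _ _ (by omega) (by omega) e
      · exact absurd e (hout _ (by omega) (by omega) _ (by omega))
      · exact absurd e.symm (hout _ (by omega) (by omega) _ (by omega))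
      · have := hinj _ _ (by omega) (by omega) (by omega) (by omega) e
        omega
    · intro t ht
      rcases lt_trichotomy t j with h | h | h
      · rw [if_pos h.le, if_pos (by omega)]; exact hu.adj t
      · subst h
        rw [if_pos le_rfl, if_neg (by omega)]
        have := hadj (ℓ - 1) (by omega)
        rw [Nat.sub_add_cancel (by omega), hpl] at this
        simpa using this.symm
      · rw [if_neg (by omega), if_neg (by omega)]
        have := hadj (ℓ - (t + 1 - j)) (by omega)
        rw [show ℓ - (t + 1 - j) + 1 = ℓ - (t - j) by omega] at this
        exact this.symm
    · rw [if_neg (by omega), if_pos (by omega)]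
      have := hadj 0 (by omega)
      rw [hp0] at this
      rw [show ℓ - (j + ℓ - 1 - j) = 0 + 1 by omega]
      exact this.symm
  have hpar := parity_of_walk hc hadj
  have hpar' := hu.parity hc j
  rw [hp0, hpl] at hpar
  exact hu.false_of_long_ear hG hp0 hpl hadj hinj hout (by omega) (by omega) hl (by omega) hn

/-- The vertices off a longest cycle are pairwise nonadjacent. -/
theorem IsCyc.not_adj_of_not_mem (hconn : G.IsTwoConnected) (hG : G.IsChoosable 4 2)
    (hu : G.IsCyc n u) (hmax : ∀ n' u', G.IsCyc n' u' → n' ≤ n) {x y : V}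
    (hx : ∀ i < n, u i ≠ x) (hy : ∀ i < n, u i ≠ y) : ¬ G.Adj x y := by
  intro hxy
  have hn := hu.three_le
  set S : Set V := {v | ∃ i < n, u i = v} with hS
  have hxS : x ∉ S := fun ⟨i, hi, h⟩ => hx i hi h
  have hyS : y ∉ S := fun ⟨i, hi, h⟩ => hy i hi h
  have h0S : u 0 ∈ S := ⟨0, by omega, rfl⟩
  have h1S : u 1 ∈ S := ⟨1, by omega, rfl⟩
  have ear : ∀ (c : V) (q : ℕ → V) (ℓ : ℕ), c ∈ S → q ℓ ∈ S → (∀ t < ℓ, q t ∉ S) →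
      (∀ t < ℓ, G.Adj (q t) (q (t + 1))) → (∀ i ≤ ℓ, ∀ j ≤ ℓ, q i = q j → i = j) →
      G.Adj c (q 0) → 2 ≤ ℓ → q ℓ = c := by
    rintro c q ℓ ⟨i, hi, rfl⟩ ⟨j, hj, hqj⟩ hq hadj hinj hc hl
    by_contra hne
    refine hu.no_long_ear hG hmax (p := fun t => if t = 0 then u i else q (t - 1)) (ℓ := ℓ + 1)
      hi hj ?_ (by simp) (by simpa using hqj.symm) ?_ ?_ ?_ (by omega)
    · rintro rfl; exact hne hqj.symm
    · intro t ht
      rcases Nat.eq_zero_or_pos t with rfl | h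
      · simpa using hc
      · have := hadj (t - 1) (by omega)
        rw [Nat.sub_add_cancel h] at this
        simpa [h.ne'] using this
    · intro s t hs hs' ht ht' e
      rw [if_neg hs.ne', if_neg ht.ne'] at e
      have := hinj _ (by omega) _ (by omega) e
      omega
    · intro t ht ht' k hk e
      rw [if_neg ht.ne'] at e
      exact hq (t - 1) (by omega) ⟨k, hk, e⟩
  -- The end of a path from `x` to the cycle supplies an outside edge with one end attached to the
  -- cycle; if the path is a single edge, `x` itself is attached.
  obtain ⟨x', y', c, hx', hy', hxy', hc, hcx⟩ : ∃ x' y' c, x' ∉ S ∧ y' ∉ S ∧ G.Adj x' y' ∧ c ∈ S ∧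
      G.Adj c x' := by
    obtain ⟨ℓ, p, a0, a1, a2, a3, -, -⟩ := hconn.exists_path (S := S) hxy.ne h0S
      (fun e => hyS (e ▸ h0S))
    rcases ℓ with _ | _ | ℓ
    · rw [a0] at a1; exact absurd a1 hxS
    · have := a3 0 (by omega)
      rw [a0] at this
      exact ⟨x, y, p 1, hxS, hyS, hxy, a1, this.symm⟩
    · exact ⟨p (ℓ + 1), p ℓ, p (ℓ + 2), a2 _ (by omega), a2 _ (by omega), (a3 ℓ (by omega)).symm,
        a1, (a3 (ℓ + 1) (by omega)).symm⟩
  obtain ⟨ℓ, p, a0, a1, a2, a3, a4, a5⟩ := hconn.exists_path (S := S) hxy'.ne.symm h0S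
      (fun e => hx' (e ▸ h0S))
  have hl : 0 < ℓ := by
    rcases Nat.eq_zero_or_pos ℓ with rfl | h
    · rw [a0] at a1; exact absurd a1 hy'
    · exact h
  -- From `d` through `x'` and `y'` along `p` the length is at least 3, so `d` must be the end of
  -- `p`. Hence `x'` has only the neighbor `c` on the cycle.
  have key : ∀ d ∈ S, G.Adj d x' → p ℓ = d := by
    intro d hd hdx
    have := ear d (fun t => if t = 0 then x' else p (t - 1)) (ℓ + 1) hd (by simpa using a1) ?_ ?_ ?_
      (by simpa using hdx) (by omega)
    · simpa using this
    · intro t ht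
      split_ifs with h
      · exact hx'
      · exact a2 _ (by omega)
    · intro t ht
      rcases Nat.eq_zero_or_pos t with rfl | h
      · simpa [a0] using hxy'
      · have := a3 (t - 1) (by omega)
        rw [Nat.sub_add_cancel h] at this
        simpa [h.ne'] using this
    · intro i hi j hj e
      split_ifs at e with e1 e2 e2
      · omega
      · exact absurd e.symm (a5 _ (by omega))
      · exact absurd e (a5 _ (by omega))
      · have := a4 _ (by omega) _ (by omega) e
        omega
  have hcs : ∃ s ∈ S, s ≠ c := by
    by_cases h : u 0 = c
    · refine ⟨u 1, h1S, fun h' => ?_⟩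
      have := hu.inj 0 1 (by omega) (by omega) (h.trans h'.symm)
      omega
    · exact ⟨u 0, h0S, h⟩
  obtain ⟨s, hsS, hsc⟩ := hcs
  -- A path from `x'` to the cycle that avoids `c` contradicts `key` if it is one edge; if it is
  -- longer, prefixing `c` gives a forbidden ear.
  obtain ⟨ℓ', q, b0, b1, b2, b3, b4, b5⟩ := hconn.exists_path (S := S) (y := x')
    (fun e => hx' (e ▸ hc)) hsS hsc
  rcases ℓ' with _ | _ | ℓ'
  · rw [b0] at b1; exact hx' b1
  · have h := b3 0 (by omega)
    rw [b0] at h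
    have e1 := key _ b1 h.symm
    have e2 := key _ hc hcx
    exact b5 1 (by omega) (e1.symm.trans e2)
  · exact b5 _ le_rfl (ear c q _ hc b1 b2 b3 b4 (by rw [b0]; exact hcx) (by omega))

/-! ### Recognizing the listed graphs -/

theorem nonempty_iso_of_bijective {W : Type*} {H : SimpleGraph W} (f : W → V)
    (hf : Function.Injective f) (hf' : Function.Surjective f)
    (h₁ : ∀ a b, H.Adj a b → G.Adj (f a) (f b))
    (h₂ : ∀ x y, G.Adj x y → ∃ a b, H.Adj a b ∧ f a = x ∧ f b = y) : Nonempty (G ≃g H) := by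
  refine ⟨(⟨Equiv.ofBijective f ⟨hf, hf'⟩, ?_⟩ : H ≃g G).symm⟩
  intro a b
  refine ⟨fun h => ?_, h₁ a b⟩
  obtain ⟨a', b', hab, ha, hb⟩ := h₂ _ _ h
  rwa [hf ha, hf hb] at hab

theorem IsCyc.nonempty_iso_cycleGraph (hu : G.IsCyc n u) (hcov : ∀ v, ∃ i < n, u i = v)
    (hE : ∀ i j, i < j → j < n → G.Adj (u i) (u j) → j = i + 1 ∨ (i = 0 ∧ j + 1 = n)) :
    Nonempty (G ≃g cycleGraph n) := by
  have hn := hu.three_le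
  have h0 : u n = u 0 := by simpa using hu.per 0
  have key : ∀ a b : Fin n, (a - b).val = 1 → G.Adj (u a) (u b) := by
    intro a b h
    rw [Fin.val_sub] at h
    have ha := a.2
    have hb := b.2
    have h' : (a : ℕ) = b + 1 ∨ ((a : ℕ) = 0 ∧ (b : ℕ) + 1 = n) := by
      rcases lt_or_ge (n - (b : ℕ) + a) n with h'' | h''
      · rw [Nat.mod_eq_of_lt h''] at h; omega
      · rw [Nat.mod_eq_sub_mod h'', Nat.mod_eq_of_lt (by omega)] at h; omega
    rcases h' with h' | ⟨h', h''⟩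
    · rw [h']; exact (hu.adj _).symm
    · have := hu.adj b
      rw [h'', h0] at this
      rw [h']; exact this.symm
  have key' : ∀ i j (hij : i < j) (hj : j < n), G.Adj (u i) (u j) →
      (cycleGraph n).Adj (⟨i, hij.trans hj⟩ : Fin n) ⟨j, hj⟩ := by
    intro i j hij hj h
    rw [cycleGraph_adj']
    rcases hE i j hij hj h with rfl | ⟨rfl, h'⟩
    · right
      rw [Fin.val_sub]
      simp only
      rw [show n - i + (i + 1) = n + 1 by omega, Nat.add_mod_left, Nat.mod_eq_of_lt (by omega)]
    · left
      rw [Fin.val_sub]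
      simp only [add_zero]
      rw [Nat.mod_eq_of_lt (by omega)]; omega
  refine nonempty_iso_of_bijective (fun i : Fin n => u i)
    (fun i j h => Fin.ext (hu.inj _ _ i.2 j.2 h)) (fun v => ?_) ?_ ?_
  · obtain ⟨i, hi, h⟩ := hcov v
    exact ⟨⟨i, hi⟩, h⟩
  · intro a b h
    rw [cycleGraph_adj'] at h
    rcases h with h | h
    · exact key _ _ h
    · exact (key _ _ h).symm
  · intro x y h
    obtain ⟨i, hi, rfl⟩ := hcov x
    obtain ⟨j, hj, rfl⟩ := hcov y
    rcases lt_trichotomy i j with hij | rfl | hij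
    · exact ⟨_, _, key' i j hij hj h, rfl, rfl⟩
    · exact absurd h (G.irrefl)
    · exact ⟨_, _, (key' j i hij hi h.symm).symm, rfl, rfl⟩

/-- A graph that is the union of internally disjoint paths with common ends is a theta graph. -/
theorem nonempty_iso_thetaGraph {k : ℕ} {ℓ : Fin k → ℕ} (P : Fin k → ℕ → V) {A B : V}
    (hAB : A ≠ B) (hA : ∀ i, P i 0 = A) (hB : ∀ i, P i (ℓ i) = B)
    (hne : ∀ i j, 0 < j → j < ℓ i → P i j ≠ A ∧ P i j ≠ B)
    (hinj : ∀ i j i' j', 0 < j → j < ℓ i → 0 < j' → j' < ℓ i' → P i j = P i' j' → i = i' ∧ j = j')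
    (hcov : ∀ v, v = A ∨ v = B ∨ ∃ i j, 0 < j ∧ j < ℓ i ∧ P i j = v)
    (hadj : ∀ i, ∀ j < ℓ i, G.Adj (P i j) (P i (j + 1)))
    (hE : ∀ x y, G.Adj x y → ∃ i, ∃ j < ℓ i, s(x, y) = s(P i j, P i (j + 1))) :
    Nonempty (G ≃g thetaGraph ℓ) := by
  let f : ThetaVert ℓ → V := fun w => match w with
    | Sum.inl false => A
    | Sum.inl true => B
    | Sum.inr ⟨i, j⟩ => P i (j + 1)
  have hf : ∀ i j, j ≤ ℓ i → f (thetaVert ℓ i j) = P i j := by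
    intro i j hj
    unfold thetaVert
    split_ifs with h0 h
    · subst h0; exact (hA i).symm
    · change P i (j - 1 + 1) = P i j
      rw [Nat.sub_add_cancel (by omega)]
    · have : j = ℓ i := by omega
      subst this; exact (hB i).symm
  have hfi : Function.Injective f := by
    rintro ((_ | _) | ⟨i, j⟩) ((_ | _) | ⟨i', j'⟩) h
    · rfl
    · exact absurd h hAB
    · exact absurd h.symm (hne i' _ (by omega) (by omega)).1
    · exact absurd h.symm hAB
    · rfl
    · exact absurd h.symm (hne i' _ (by omega) (by omega)).2
    · exact absurd h (hne i _ (by omega) (by omega)).1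
    · exact absurd h (hne i _ (by omega) (by omega)).2
    · obtain ⟨rfl, h'⟩ := hinj _ _ _ _ (by omega) (by omega) (by omega) (by omega) h
      have : j = j' := Fin.ext (by omega)
      rw [this]
  refine nonempty_iso_of_bijective f hfi (fun v => ?_) ?_ ?_
  · rcases hcov v with rfl | rfl | ⟨i, j, h0, h, rfl⟩
    · exact ⟨Sum.inl false, rfl⟩
    · exact ⟨Sum.inl true, rfl⟩
    · exact ⟨thetaVert ℓ i j, hf i j h.le⟩
  · intro a b h
    rw [thetaGraph, fromEdgeSet_adj] at h
    obtain ⟨⟨i, j, hj, e⟩, -⟩ := h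
    have hij := hadj i j hj
    rw [← hf i j hj.le, ← hf i (j + 1) hj] at hij
    rcases Sym2.eq_iff.1 e with ⟨rfl, rfl⟩ | ⟨rfl, rfl⟩
    · exact hij
    · exact hij.symm
  · intro x y h
    obtain ⟨i, j, hj, e⟩ := hE x y h
    have hT : (thetaGraph ℓ).Adj (thetaVert ℓ i j) (thetaVert ℓ i (j + 1)) := by
      rw [thetaGraph, fromEdgeSet_adj]
      refine ⟨⟨i, j, hj, rfl⟩, fun e' => ?_⟩
      have := congrArg f e'
      rw [hf i j hj.le, hf i (j + 1) hj] at this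
      exact (hadj i j hj).ne this
    rcases Sym2.eq_iff.1 e with ⟨rfl, rfl⟩ | ⟨rfl, rfl⟩
    · exact ⟨_, _, hT, hf i j hj.le, hf i _ hj⟩
    · exact ⟨_, _, hT.symm, hf i _ hj, hf i j hj.le⟩

theorem K33MinusEdge_adj_zero_one : K33MinusEdge.Adj (Sum.inl 0) (Sum.inr 1) := by
  simp [K33MinusEdge]

theorem ncard_neighborSet_K33MinusEdge :
    (K33MinusEdge.neighborSet (Sum.inl 0)).ncard = 2 := by
  have : K33MinusEdge.neighborSet (Sum.inl 0) = {Sum.inr 1, Sum.inr 2} := by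
    ext x
    rcases x with x | x <;> fin_cases x <;> simp [K33MinusEdge]
  rw [this, Set.ncard_pair (by simp)]

/-- A cycle with the two chords `{0, 3}` and `{1, 4}` is a subdivision of `K_{3,3} - e`. -/
theorem IsCyc.nonempty_iso_subdivideEdge {N : ℕ} (hu : G.IsCyc (N + 6) u)
    (hcov : ∀ v, ∃ i < N + 6, u i = v) (h₀ : G.Adj (u 0) (u 3)) (h₁ : G.Adj (u 1) (u 4))
    (hE : ∀ i j, i < j → j < N + 6 → G.Adj (u i) (u j) →
      j = i + 1 ∨ (i = 0 ∧ j + 1 = N + 6) ∨ (i = 0 ∧ j = 3) ∨ (i = 1 ∧ j = 4)) :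
    Nonempty (G ≃g K33MinusEdge.subdivideEdge (Sum.inl 0) (Sum.inr 1) N) := by
  -- The missing edge of K_{3,3} joins positions 5 and 2. The subdivided edge, at the degree-2
  -- vertex `inl 0`, becomes the arc from position 5 through 6, …, N + 5 back to 0.
  let g : (Fin 3 ⊕ Fin 3) ⊕ Fin N → ℕ := fun w => match w with
    | Sum.inl (Sum.inl 0) => 5
    | Sum.inl (Sum.inl 1) => 1
    | Sum.inl (Sum.inl 2) => 3
    | Sum.inl (Sum.inr 0) => 2
    | Sum.inl (Sum.inr 1) => 0
    | Sum.inl (Sum.inr 2) => 4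
    | Sum.inr k => 6 + k
  have hg : ∀ w, g w < N + 6 := by
    rintro ((w | w) | w)
    · fin_cases w <;> simp [g]
    · fin_cases w <;> simp [g]
    · simp only [g]; omega
  have hgi : Function.Injective g := by
    rintro ((w | w) | w) ((w' | w') | w') h
    · fin_cases w <;> fin_cases w' <;> simp [g] at h ⊢
    · fin_cases w <;> fin_cases w' <;> simp [g] at h
    · fin_cases w <;> simp [g] at h <;> omega
    · fin_cases w <;> fin_cases w' <;> simp [g] at h
    · fin_cases w <;> fin_cases w' <;> simp [g] at h ⊢
    · fin_cases w <;> simp [g] at h <;> omega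
    · fin_cases w' <;> simp [g] at h <;> omega
    · fin_cases w' <;> simp [g] at h <;> omega
    · simp only [g] at h
      rw [Fin.ext (by omega : (w : ℕ) = w')]
  have hu6 : u (5 + (N + 1)) = u 0 := by
    rw [show 5 + (N + 1) = 0 + (N + 6) by omega]; exact hu.per 0
  have hsub : ∀ j ≤ N + 1, u (g (subdivVert (Sum.inl 0) (Sum.inr 1) N j)) = u (5 + j) := by
    intro j hj
    unfold subdivVert
    split_ifs with h0 h
    · subst h0; rfl
    · simp only [g]
      rw [show 6 + (j - 1) = 5 + j by omega]
    · have : j = N + 1 := by omega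
      subst this; exact hu6.symm
  have hold : ∀ a b : Fin 3 ⊕ Fin 3, K33MinusEdge.Adj a b → s(a, b) ≠ s(Sum.inl 0, Sum.inr 1) →
      (K33MinusEdge.subdivideEdge (Sum.inl 0) (Sum.inr 1) N).Adj (Sum.inl a) (Sum.inl b) := by
    intro a b hab hne
    rw [subdivideEdge, fromEdgeSet_adj]
    refine ⟨Or.inl ⟨s(a, b), ⟨hab, hne⟩, by simp⟩, fun h => hab.ne (Sum.inl_injective h)⟩
  have hnew : ∀ j ≤ N, (K33MinusEdge.subdivideEdge (Sum.inl 0) (Sum.inr 1) N).Adj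
      (subdivVert (Sum.inl 0) (Sum.inr 1) N j) (subdivVert (Sum.inl 0) (Sum.inr 1) N (j + 1)) := by
    intro j hj
    rw [subdivideEdge, fromEdgeSet_adj]
    refine ⟨Or.inr ⟨j, hj, rfl⟩, fun h => ?_⟩
    have := congrArg (fun w => u (g w)) h
    rw [hsub j (by omega), hsub (j + 1) (by omega)] at this
    exact (hu.adj (5 + j)).ne this
  have hdown : ∀ i j, i < j → j < N + 6 → G.Adj (u i) (u j) → ∃ a b,
      (K33MinusEdge.subdivideEdge (Sum.inl 0) (Sum.inr 1) N).Adj a b ∧ u (g a) = u i ∧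
        u (g b) = u j := by
    intro i j hij hj h
    rcases hE i j hij hj h with rfl | ⟨rfl, h'⟩ | ⟨rfl, rfl⟩ | ⟨rfl, rfl⟩
    · by_cases hi : 5 ≤ i
      · obtain ⟨t, rfl⟩ := Nat.exists_eq_add_of_le hi
        exact ⟨_, _, hnew t (by omega), hsub t (by omega), hsub (t + 1) (by omega)⟩
      · interval_cases i
        · exact ⟨_, _, hold (Sum.inr 1) (Sum.inl 1) (by simp [K33MinusEdge]) (by simp), rfl, rfl⟩
        · exact ⟨_, _, hold (Sum.inl 1) (Sum.inr 0) (by simp [K33MinusEdge]) (by simp), rfl, rfl⟩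
        · exact ⟨_, _, hold (Sum.inr 0) (Sum.inl 2) (by simp [K33MinusEdge]) (by simp), rfl, rfl⟩
        · exact ⟨_, _, hold (Sum.inl 2) (Sum.inr 2) (by simp [K33MinusEdge]) (by simp), rfl, rfl⟩
        · exact ⟨_, _, hold (Sum.inr 2) (Sum.inl 0) (by simp [K33MinusEdge]) (by simp), rfl, rfl⟩
    · have hj' : j = 5 + N := by omega
      subst hj'
      exact ⟨_, _, (hnew N le_rfl).symm, (hsub (N + 1) le_rfl).trans hu6, hsub N (by omega)⟩
    · exact ⟨_, _, hold (Sum.inr 1) (Sum.inl 2) (by simp [K33MinusEdge]) (by simp), rfl, rfl⟩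
    · exact ⟨_, _, hold (Sum.inl 1) (Sum.inr 2) (by simp [K33MinusEdge]) (by simp), rfl, rfl⟩
  refine nonempty_iso_of_bijective (fun w => u (g w))
    (fun a b h => hgi (hu.inj _ _ (hg a) (hg b) h)) (fun v => ?_) ?_ ?_
  · obtain ⟨i, hi, rfl⟩ := hcov v
    by_cases h6 : 6 ≤ i
    · obtain ⟨t, rfl⟩ := Nat.exists_eq_add_of_le h6
      exact ⟨Sum.inr ⟨t, by omega⟩, rfl⟩
    · interval_cases i
      · exact ⟨Sum.inl (Sum.inr 1), rfl⟩
      · exact ⟨Sum.inl (Sum.inl 1), rfl⟩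
      · exact ⟨Sum.inl (Sum.inr 0), rfl⟩
      · exact ⟨Sum.inl (Sum.inl 2), rfl⟩
      · exact ⟨Sum.inl (Sum.inr 2), rfl⟩
      · exact ⟨Sum.inl (Sum.inl 0), rfl⟩
  · intro a b h
    rw [subdivideEdge, fromEdgeSet_adj] at h
    obtain ⟨⟨e, ⟨he, he'⟩, h⟩ | ⟨j, hj, h⟩, -⟩ := h
    · induction e with
      | _ x y =>
      have hxy : G.Adj (u (g (Sum.inl x))) (u (g (Sum.inl y))) := by
        have a01 := hu.adj 0
        have a12 := hu.adj 1
        have a23 := hu.adj 2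
        have a34 := hu.adj 3
        have a45 := hu.adj 4
        rw [mem_edgeSet] at he
        rcases x with x | x <;> rcases y with y | y <;> fin_cases x <;> fin_cases y <;>
          simp [K33MinusEdge, g, G.adj_comm] at he he' ⊢ <;>
          assumption
      rw [Sym2.map_mk] at h
      rcases Sym2.eq_iff.1 h with ⟨rfl, rfl⟩ | ⟨rfl, rfl⟩
      · exact hxy
      · exact hxy.symm
    · have := hu.adj (5 + j)
      rw [add_assoc, ← hsub j (by omega), ← hsub (j + 1) (by omega)] at this
      rcases Sym2.eq_iff.1 h with ⟨rfl, rfl⟩ | ⟨rfl, rfl⟩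
      · exact this
      · exact this.symm
  · intro x y h
    obtain ⟨i, hi, rfl⟩ := hcov x
    obtain ⟨j, hj, rfl⟩ := hcov y
    rcases lt_trichotomy i j with hij | rfl | hij
    · exact hdown i j hij hj h
    · exact absurd h (G.irrefl)
    · obtain ⟨a, b, hab, ha, hb⟩ := hdown j i hij hi h.symm
      exact ⟨b, a, hab.symm, hb, ha⟩

theorem forall_fin_three {Q : Fin 3 → Prop} (h₀ : Q 0) (h₁ : Q 1) (h₂ : Q 2) : ∀ i, Q i := by
  intro i
  fin_cases i
  exacts [h₀, h₁, h₂]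

theorem forall_fin_four {Q : Fin 4 → Prop} (h₀ : Q 0) (h₁ : Q 1) (h₂ : Q 2) (h₃ : Q 3) :
    ∀ i, Q i := by
  intro i
  fin_cases i
  exacts [h₀, h₁, h₂, h₃]

/-- A cycle with one ear is a theta graph. -/
theorem IsCyc.nonempty_iso_thetaGraph (hu : G.IsCyc n u) {p : ℕ → V} {a ℓ : ℕ} (ha : 0 < a)
    (han : a < n) (hp0 : p 0 = u 0) (hpl : p ℓ = u a) (hadj : ∀ t < ℓ, G.Adj (p t) (p (t + 1)))
    (hinj : ∀ s t, 0 < s → s < ℓ → 0 < t → t < ℓ → p s = p t → s = t)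
    (hout : ∀ t, 0 < t → t < ℓ → ∀ i < n, u i ≠ p t)
    (hcov : ∀ v, (∃ i < n, u i = v) ∨ ∃ t, 0 < t ∧ t < ℓ ∧ p t = v)
    (hE : ∀ x y, G.Adj x y → (∃ i < n, s(x, y) = s(u i, u (i + 1))) ∨
      ∃ t < ℓ, s(x, y) = s(p t, p (t + 1))) :
    Nonempty (G ≃g thetaGraph ![ℓ, a, n - a]) := by
  have hn := hu.three_le
  have h0 : u n = u 0 := by simpa using hu.per 0
  refine SimpleGraph.nonempty_iso_thetaGraph ![p, u, fun j => u (n - j)] (A := u 0) (B := u a)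
    ?_ ?_ ?_ ?_ ?_ ?_ ?_ ?_
  · intro h
    have := hu.inj _ _ (by omega) han h
    omega
  · exact forall_fin_three hp0 rfl h0
  · refine forall_fin_three hpl rfl ?_
    change u (n - (n - a)) = u a
    rw [show n - (n - a) = a by omega]
  · refine forall_fin_three ?_ ?_ ?_
    · intro j (hj : 0 < j) (hj' : j < ℓ)
      exact ⟨(hout j hj hj' 0 (by omega)).symm, (hout j hj hj' a han).symm⟩
    · intro j (hj : 0 < j) (hj' : j < a)
      constructor
      · intro h
        have := hu.inj _ _ (by omega) (by omega) h
        omega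
      · intro h
        have := hu.inj _ _ (by omega) (by omega) h
        omega
    · intro j (hj : 0 < j) (hj' : j < n - a)
      constructor
      · intro (h : u (n - j) = u 0)
        have := hu.inj _ _ (by omega) (by omega) h
        omega
      · intro (h : u (n - j) = u a)
        have := hu.inj _ _ (by omega) (by omega) h
        omega
  · intro i j i' j'
    revert i i'
    refine forall_fin_three (forall_fin_three ?_ ?_ ?_) (forall_fin_three ?_ ?_ ?_)
      (forall_fin_three ?_ ?_ ?_)
    · exact fun h1 h2 h3 h4 h => ⟨rfl, hinj _ _ h1 h2 h3 h4 h⟩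
    · intro (h1 : 0 < j) (h2 : j < ℓ) (h3 : 0 < j') (h4 : j' < a) h
      exact absurd h.symm (hout j h1 h2 j' (by omega))
    · intro (h1 : 0 < j) (h2 : j < ℓ) (h3 : 0 < j') (h4 : j' < n - a) h
      exact absurd h.symm (hout j h1 h2 (n - j') (by omega))
    · intro (h1 : 0 < j) (h2 : j < a) (h3 : 0 < j') (h4 : j' < ℓ) h
      exact absurd h (hout j' h3 h4 j (by omega))
    · intro (h1 : 0 < j) (h2 : j < a) (h3 : 0 < j') (h4 : j' < a) h
      exact ⟨rfl, hu.inj _ _ (by omega) (by omega) h⟩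
    · intro (h1 : 0 < j) (h2 : j < a) (h3 : 0 < j') (h4 : j' < n - a) (h : u j = u (n - j'))
      have := hu.inj _ _ (by omega) (by omega) h
      omega
    · intro (h1 : 0 < j) (h2 : j < n - a) (h3 : 0 < j') (h4 : j' < ℓ) h
      exact absurd h (hout j' h3 h4 (n - j) (by omega))
    · intro (h1 : 0 < j) (h2 : j < n - a) (h3 : 0 < j') (h4 : j' < a) (h : u (n - j) = u j')
      have := hu.inj _ _ (by omega) (by omega) h
      omega
    · intro (h1 : 0 < j) (h2 : j < n - a) (h3 : 0 < j') (h4 : j' < n - a)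
        (h : u (n - j) = u (n - j'))
      have := hu.inj _ _ (by omega) (by omega) h
      exact ⟨rfl, by omega⟩
  · intro v
    rcases hcov v with ⟨i, hi, rfl⟩ | ⟨t, ht, ht', rfl⟩
    · rcases Nat.eq_zero_or_pos i with rfl | hi0
      · exact Or.inl rfl
      rcases lt_trichotomy i a with h | rfl | h
      · exact Or.inr (Or.inr ⟨1, i, hi0, h, rfl⟩)
      · exact Or.inr (Or.inl rfl)
      · refine Or.inr (Or.inr ⟨2, n - i, by omega, ?_, ?_⟩)
        · change n - i < n - a
          omega
        · change u (n - (n - i)) = u i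
          rw [show n - (n - i) = i by omega]
    · exact Or.inr (Or.inr ⟨0, t, ht, ht', rfl⟩)
  · refine forall_fin_three hadj (fun j _ => hu.adj j) ?_
    intro j (hj : j < n - a)
    change G.Adj (u (n - j)) (u (n - (j + 1)))
    have := hu.adj (n - (j + 1))
    rw [show n - (j + 1) + 1 = n - j by omega] at this
    exact this.symm
  · intro x y h
    rcases hE x y h with ⟨i, hi, h⟩ | ⟨t, ht, h⟩
    · rcases lt_or_ge i a with h' | h'
      · exact ⟨1, i, h', h⟩
      · refine ⟨2, n - (i + 1), ?_, ?_⟩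
        · change n - (i + 1) < n - a
          omega
        · change s(x, y) = s(u (n - (n - (i + 1))), u (n - (n - (i + 1) + 1)))
          rw [h, show n - (n - (i + 1)) = i + 1 by omega,
            show n - (n - (i + 1) + 1) = i by omega, Sym2.eq_swap]
    · exact ⟨0, t, ht, h⟩

/-! ### Chords and outside vertices in arbitrary position -/

theorem IsCyc.not_mem_rotate (hu : G.IsCyc n u) {v : V} (hv : ∀ i < n, u i ≠ v) (k : ℕ) :
    ∀ i < n, u (i + k) ≠ v := by
  intro i hi
  rw [← hu.mod]
  exact hv _ (Nat.mod_lt _ (by omega))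

theorem IsCyc.exists_rotate (hu : G.IsCyc n u) (k : ℕ) {v : V} (hv : ∃ i < n, u i = v) :
    ∃ i < n, u (i + k) = v := by
  by_contra h
  push Not at h
  obtain ⟨i, hi, rfl⟩ := hv
  have hk : k % n < n := Nat.mod_lt _ (by omega)
  refine (hu.rotate k).not_mem_rotate h (n - k % n) i hi ?_
  have e : i + (n - k % n) + k = i + n * (k / n + 1) := by
    have := Nat.mod_add_div k n
    rw [Nat.mul_add, Nat.mul_one]
    omega
  rw [e, ← hu.mod, Nat.add_mul_mod_self_left, hu.mod]

/-- An edge between nonconsecutive vertices of a cycle. -/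
def IsChord (G : SimpleGraph V) (n : ℕ) (u : ℕ → V) (i j : ℕ) : Prop :=
  G.Adj (u i) (u j) ∧ i + 1 < j ∧ j < n ∧ ¬ (i = 0 ∧ j + 1 = n)

theorem IsChord.odd (hu : G.IsCyc n u) {c : V → ℕ}
    (hc : ∀ v w, G.Adj v w → (c v + c w) % 2 = 1) {i j : ℕ} (h : IsChord G n u i j) :
    (i + j) % 2 = 1 := by
  have h1 := hu.parity hc i
  have h2 := hu.parity hc j
  have h3 := hc _ _ h.1
  omega

theorem IsChord.rotate (hu : G.IsCyc n u) {c : V → ℕ}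
    (hc : ∀ v w, G.Adj v w → (c v + c w) % 2 = 1) {i j : ℕ} (h : IsChord G n u i j) :
    IsChord G n (fun t => u (t + i)) 0 (j - i) := by
  have ho := h.odd hu hc
  have hn := hu.even hc
  obtain ⟨h1, h2, h3, h4⟩ := h
  refine ⟨?_, by omega, by omega, by omega⟩
  simpa [Nat.sub_add_cancel (by omega : i ≤ j)] using h1

theorem IsCyc.neighbors_parity (hu : G.IsCyc n u) {c : V → ℕ}
    (hc : ∀ v w, G.Adj v w → (c v + c w) % 2 = 1) {v : V} {i j : ℕ} (hi : G.Adj v (u i))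
    (hj : G.Adj v (u j)) : (i + j) % 2 = 0 := by
  have h1 := hu.parity hc i
  have h2 := hu.parity hc j
  have h3 := hc _ _ hi
  have h4 := hc _ _ hj
  omega

/-- A vertex off the cycle has at most two neighbors on it. -/
theorem IsCyc.neighbor_eq_or_eq (hG : G.IsChoosable 4 2) (hu : G.IsCyc n u) {v : V}
    (hv : ∀ i < n, u i ≠ v) {a b : ℕ} (h₀ : G.Adj v (u 0)) (ha : G.Adj v (u a))
    (hb : G.Adj v (u b)) (ha0 : 0 < a) (han : a < n) (hbn : b < n) : b = 0 ∨ b = a := by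
  obtain ⟨c, hc⟩ := hG.exists_parity
  have hn := hu.even hc
  have p1 := hu.neighbors_parity hc h₀ ha
  have p2 := hu.neighbors_parity hc h₀ hb
  by_contra hcon
  rcases lt_or_ge a b with h | h
  · exact hu.false_of_three_neighbors hG hv h₀ ha hb ha0 h hbn (by omega) (by omega) hn
  · exact hu.false_of_three_neighbors hG hv h₀ hb ha (by omega) (by omega) han (by omega)
      (by omega) hn

/-- The two neighbor pairs either cross or do not. A non-crossing pair is brought to the standard
order by rotating and exchanging `v` and `w`, or by reading position 0 as `n`. -/
theorem IsCyc.false_of_two_vertices (hG : G.IsChoosable 4 2) (hu : G.IsCyc n u) {v w : V}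
    (hv : ∀ i < n, u i ≠ v) (hw : ∀ i < n, u i ≠ w) (hvw : v ≠ w) {a p q : ℕ}
    (h₁ : G.Adj v (u 0)) (h₂ : G.Adj v (u a)) (h₃ : G.Adj w (u p)) (h₄ : G.Adj w (u q))
    (ha : 0 < a) (han : a < n) (hpq : p < q) (hq : q < n) (h6 : 6 ≤ n) : False := by
  obtain ⟨c, hc⟩ := hG.exists_parity
  have hn := hu.even hc
  have p1 := hu.neighbors_parity hc h₁ h₂
  have p2 := hu.neighbors_parity hc h₃ h₄
  have h0 : u n = u 0 := by simpa using hu.per 0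
  rcases le_or_gt a p with hap | hap
  · exact hu.false_of_noncrossing_vertices hG hv hw hvw h₁ h₂ h₃ h₄ ha hap hpq hq.le (by omega) p2
      hn h6
  rcases le_or_gt q a with hqa | hqa
  · refine (hu.rotate p).false_of_noncrossing_vertices hG (hu.not_mem_rotate hw p)
      (hu.not_mem_rotate hv p) hvw.symm (a := q - p) (p := a - p) (q := n - p) (by simpa using h₃)
      ?_ ?_ ?_ (by omega) (by omega) (by omega) (by omega) (by omega) (by omega) hn h6
    · rwa [Nat.sub_add_cancel hpq.le]
    · rwa [Nat.sub_add_cancel hap.le]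
    · rwa [Nat.sub_add_cancel (by omega), h0]
  rcases Nat.eq_zero_or_pos p with rfl | hp
  · exact hu.false_of_noncrossing_vertices hG hv hw hvw h₁ h₂ h₄ (h0 ▸ h₃) ha hqa.le hq le_rfl
      (by omega) (by omega) hn h6
  · exact hu.false_of_crossing_vertices hG hv hw hvw h₁ h₂ h₃ h₄ hp hap hqa hq (by omega) p2 hn h6

theorem IsCyc.false_of_chord_of_vertex (hG : G.IsChoosable 4 2) (hu : G.IsCyc n u) {v : V}
    (hv : ∀ i < n, u i ≠ v) {a p q : ℕ} (h₁ : IsChord G n u 0 a) (h₂ : G.Adj v (u p))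
    (h₃ : G.Adj v (u q)) (hpq : p < q) (hq : q < n) : False := by
  obtain ⟨c, hc⟩ := hG.exists_parity
  have hn := hu.even hc
  have p1 := h₁.odd hu hc
  have p2 := hu.neighbors_parity hc h₂ h₃
  have h0 : u n = u 0 := by simpa using hu.per 0
  obtain ⟨h₁, b1, b2, b3⟩ := h₁
  rcases le_or_gt a p with hap | hap
  · exact hu.false_of_chord_of_noncrossing_vertex hG hv h₁ h₂ h₃ (by omega) hap hpq hq.le (by omega)
      p2 hn
  rcases le_or_gt q a with hqa | hqa
  · refine (hu.rotate a).false_of_chord_of_noncrossing_vertex hG (hu.not_mem_rotate hv a)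
      (a := n - a) (p := p + (n - a)) (q := q + (n - a)) ?_ ?_ ?_ (by omega) (by omega) (by omega)
      (by omega) (by omega) (by omega) hn
    · rw [Nat.sub_add_cancel b2.le, h0, zero_add]; exact h₁.symm
    · rwa [show p + (n - a) + a = p + n by omega, hu.per]
    · rwa [show q + (n - a) + a = q + n by omega, hu.per]
  rcases Nat.eq_zero_or_pos p with rfl | hp
  · exact hu.false_of_chord_of_noncrossing_vertex hG hv h₁ h₃ (h0 ▸ h₂) (by omega) hqa.le hq le_rfl
      (by omega) (by omega) hn
  · exact hu.false_of_chord_of_crossing_vertex hG hv h₁ h₂ h₃ hp hap hqa hq (by omega) p2 hn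

/-- Two chords of a cycle cross, and all arcs between their ends but one have length at most
two. -/
theorem IsChord.crossing (hG : G.IsChoosable 4 2) (hu : G.IsCyc n u) {a p q : ℕ}
    (h₁ : IsChord G n u 0 a) (h₂ : IsChord G n u p q) (hne : ¬ (p = 0 ∧ q = a)) :
    (p = 1 ∧ q = a + 1 ∧ (a = 3 ∨ n = q + 2)) ∨ (a = p + 1 ∧ n = q + 1 ∧ (p = 2 ∨ q = a + 2)) := by
  obtain ⟨c, hc⟩ := hG.exists_parity
  have hn := hu.even hc
  have p1 := h₁.odd hu hc
  have p2 := h₂.odd hu hc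
  have h0 : u n = u 0 := by simpa using hu.per 0
  obtain ⟨h₁, b1, b2, b3⟩ := h₁
  obtain ⟨h₂, d1, d2, d3⟩ := h₂
  rcases le_or_gt a p with hap | hap
  · exact (hu.false_of_noncrossing_chords hG h₁ h₂ (by omega) hap (by omega) d2.le (by omega) p2 hn
      (by omega)).elim
  rcases le_or_gt q a with hqa | hqa
  · refine ((hu.rotate a).false_of_noncrossing_chords hG
      (a := n - a) (p := p + (n - a)) (q := q + (n - a)) ?_ ?_ (by omega) (by omega) (by omega)
      (by omega) (by omega) (by omega) hn (by omega)).elim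
    · rw [Nat.sub_add_cancel b2.le, h0, zero_add]; exact h₁.symm
    · rwa [show p + (n - a) + a = p + n by omega, hu.per,
        show q + (n - a) + a = q + n by omega, hu.per]
  rcases Nat.eq_zero_or_pos p with rfl | hp
  · rw [← h0] at h₂
    exact (hu.false_of_noncrossing_chords hG h₁ h₂.symm (by omega) hqa.le (by omega) le_rfl
      (by omega) (by omega) hn (by omega)).elim
  · exact hu.crossing_chords hG h₁ h₂ hp hap hqa d2 (by omega) p2 hn

theorem IsCyc.adj_cases (hu : G.IsCyc n u) {i j : ℕ} (hi : i < n) (hj : j < n)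
    (h : G.Adj (u i) (u j)) : (∃ k < n, s(u i, u j) = s(u k, u (k + 1))) ∨
      IsChord G n u i j ∨ IsChord G n u j i := by
  have h0 : u n = u 0 := by simpa using hu.per 0
  have key : ∀ i j, i < j → j < n → G.Adj (u i) (u j) →
      (∃ k < n, s(u i, u j) = s(u k, u (k + 1))) ∨ IsChord G n u i j := by
    intro i j hij hj h
    by_cases h1 : j = i + 1
    · exact Or.inl ⟨i, by omega, by rw [h1]⟩
    by_cases h2 : i = 0 ∧ j + 1 = n
    · refine Or.inl ⟨j, hj, ?_⟩
      rw [h2.2, h0, h2.1, Sym2.eq_swap]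
    · exact Or.inr ⟨h, by omega, hj, h2⟩
  rcases lt_trichotomy i j with hij | rfl | hij
  · exact (key i j hij hj h).imp_right Or.inl
  · exact absurd h (G.irrefl)
  · rw [Sym2.eq_swap]
    exact (key j i hij hi h.symm).imp_right Or.inr

/-- 2-connectedness gives two neighbors, and both lie on the cycle because outside vertices are
pairwise nonadjacent. -/
theorem IsCyc.exists_neighbors [Fintype V] (hcard : 3 ≤ Fintype.card V)
    (hconn : G.IsTwoConnected) (hG : G.IsChoosable 4 2) (hu : G.IsCyc n u)
    (hmax : ∀ n' u', G.IsCyc n' u' → n' ≤ n) {v : V} (hv : ∀ i < n, u i ≠ v) :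
    ∃ p q, p < q ∧ q < n ∧ G.Adj v (u p) ∧ G.Adj v (u q) := by
  obtain ⟨a, b, ha, hb, hab⟩ := hconn.exists_two_adj hcard v
  have key : ∀ w, G.Adj v w → ∃ i < n, u i = w := by
    intro w hw
    by_contra h
    push Not at h
    exact hu.not_adj_of_not_mem hconn hG hmax hv h hw
  obtain ⟨i, hi, rfl⟩ := key a ha
  obtain ⟨j, hj, rfl⟩ := key b hb
  rcases lt_trichotomy i j with h | rfl | h
  · exact ⟨i, j, h, hj, ha, hb⟩
  · exact absurd rfl hab
  · exact ⟨j, i, h, hi, hb, ha⟩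

/-- Two vertices attached to a longest cycle of length four have the same neighbors. -/
theorem IsCyc.adj_of_four [Fintype V] (hcard : 3 ≤ Fintype.card V)
    (hconn : G.IsTwoConnected) (hG : G.IsChoosable 4 2) (hu : G.IsCyc 4 u)
    (hmax : ∀ n' u', G.IsCyc n' u' → n' ≤ 4) {v w : V} (hv : ∀ i < 4, u i ≠ v)
    (hw : ∀ i < 4, u i ≠ w) (hvw : v ≠ w) (h₀ : G.Adj v (u 0)) (h₂ : G.Adj v (u 2)) :
    G.Adj w (u 0) ∧ G.Adj w (u 2) := by
  obtain ⟨c, hc⟩ := hG.exists_parity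
  obtain ⟨p, q, hpq, hq, hp', hq'⟩ := hu.exists_neighbors hcard hconn hG hmax hw
  have hpar := hu.neighbors_parity hc hp' hq'
  have h4 : u 4 = u 0 := hu.per 0
  have cases : (p = 0 ∧ q = 2) ∨ (p = 1 ∧ q = 3) := by omega
  rcases cases with ⟨rfl, rfl⟩ | ⟨rfl, rfl⟩
  · exact ⟨hp', hq'⟩
  -- If `w` were attached at 1 and 3, exchanging `u 1` for `v` would give another longest cycle that
  -- misses the adjacent vertices `u 1` and `w`.
  have hu' : G.IsCyc 4 (fun i => (fun t => if t = 1 then v else u t) (i % 4)) := by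
    refine IsCyc.of_path (n := 4) (f := fun t => if t = 1 then v else u t) (by norm_num) ?_ ?_ ?_
    · intro i j hi hj e
      split_ifs at e with e1 e2 e2
      · omega
      · exact absurd e.symm (hv j hj)
      · exact absurd e (hv i hi)
      · exact hu.inj i j hi hj e
    · intro i hi
      obtain rfl | rfl | rfl : i = 0 ∨ i = 1 ∨ i = 2 := by omega
      · simpa using h₀.symm
      · simpa using h₂
      · simpa using hu.adj 2
    · have := hu.adj 3
      rw [h4] at this
      simpa using this
  refine absurd hp'.symm (hu'.not_adj_of_not_mem hconn hG hmax ?_ ?_)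
  · intro i hi
    simp only [Nat.mod_eq_of_lt hi]
    split_ifs with h
    · exact (hv 1 (by omega)).symm
    · exact fun e => h (hu.inj i 1 hi (by omega) e)
  · intro i hi
    simp only [Nat.mod_eq_of_lt hi]
    split_ifs with h
    · exact hvw
    · exact hw i hi

theorem IsCyc.nonempty_iso_theta_two_two_two_two (hG : G.IsChoosable 4 2) (hu : G.IsCyc 4 u)
    (hch : ∀ i j, ¬ IsChord G 4 u i j) {v w : V} (hv : ∀ i < 4, u i ≠ v) (hw : ∀ i < 4, u i ≠ w)
    (hvw : v ≠ w) (hv₀ : G.Adj v (u 0)) (hv₂ : G.Adj v (u 2)) (hw₀ : G.Adj w (u 0))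
    (hw₂ : G.Adj w (u 2)) (hnadj : ¬ G.Adj v w) (hcov : ∀ x, (∃ i < 4, u i = x) ∨ x = v ∨ x = w) :
    Nonempty (G ≃g thetaGraph ![2, 2, 2, 2]) := by
  have h4 : u 4 = u 0 := hu.per 0
  have hne : ∀ i j, i < 4 → j < 4 → i ≠ j → u i ≠ u j := fun i j hi hj h e => h (hu.inj i j hi hj e)
  have hl : ∀ i, (![2, 2, 2, 2] : Fin 4 → ℕ) i = 2 := forall_fin_four rfl rfl rfl rfl
  let mid : Fin 4 → V := ![v, u 1, u 3, w]
  have hmid0 : ∀ i, G.Adj (u 0) (mid i) :=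
    forall_fin_four hv₀.symm (hu.adj 0) (h4 ▸ (hu.adj 3).symm) hw₀.symm
  have hmid2 : ∀ i, G.Adj (mid i) (u 2) :=
    forall_fin_four hv₂ (hu.adj 1) (hu.adj 2).symm hw₂
  have hmidi : ∀ i i', mid i = mid i' → i = i' := by
    have a1 := hv 1 (by omega)
    have a2 := hv 3 (by omega)
    have a3 := hw 1 (by omega)
    have a4 := hw 3 (by omega)
    have a5 := hne 1 3 (by omega) (by omega) (by omega)
    refine forall_fin_four (forall_fin_four ?_ ?_ ?_ ?_) (forall_fin_four ?_ ?_ ?_ ?_)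
      (forall_fin_four ?_ ?_ ?_ ?_) (forall_fin_four ?_ ?_ ?_ ?_) <;> intro h
    · rfl
    · exact absurd h.symm a1
    · exact absurd h.symm a2
    · exact absurd h hvw
    · exact absurd h a1
    · rfl
    · exact absurd h a5
    · exact absurd h a3
    · exact absurd h a2
    · exact absurd h.symm a5
    · rfl
    · exact absurd h a4
    · exact absurd h.symm hvw
    · exact absurd h.symm a3
    · exact absurd h.symm a4
    · rfl
  let P : Fin 4 → ℕ → V := fun i j => if j = 0 then u 0 else if j = 1 then mid i else u 2
  have e0 : ∀ i, s(u 0, mid i) = s(P i 0, P i 1) := fun i => rfl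
  have e1 : ∀ i, s(mid i, u 2) = s(P i 1, P i 2) := fun i => rfl
  have hout : ∀ (x : V) (k : Fin 4) (y : V), mid k = x → (∀ i < 4, u i ≠ x) → G.Adj x (u 0) →
      G.Adj x (u 2) → G.Adj x y → (∃ i < 4, u i = y) →
      ∃ i : Fin 4, ∃ j < 2, s(x, y) = s(P i j, P i (j + 1)) := by
    rintro x k y rfl hx hx0 hx2 hxy ⟨b, hb, rfl⟩
    rcases hu.neighbor_eq_or_eq hG hx hx0 hx2 hxy (by omega) (by omega) hb with rfl | rfl
    · exact ⟨k, 0, by omega, by rw [Sym2.eq_swap]; exact e0 k⟩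
    · exact ⟨k, 1, by omega, e1 k⟩
  refine SimpleGraph.nonempty_iso_thetaGraph P (A := u 0) (B := u 2)
    (hne 0 2 (by omega) (by omega) (by omega)) (fun i => rfl) ?_ ?_ ?_ ?_ ?_ ?_
  · intro i
    rw [hl]; rfl
  · intro i j h1 h2
    rw [hl] at h2
    obtain rfl : j = 1 := by omega
    exact ⟨(hmid0 i).ne.symm, (hmid2 i).ne⟩
  · intro i j i' j' h1 h2 h3 h4 h
    rw [hl] at h2 h4
    obtain rfl : j = 1 := by omega
    obtain rfl : j' = 1 := by omega
    exact ⟨hmidi i i' h, rfl⟩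
  · intro x
    rcases hcov x with ⟨i, hi, rfl⟩ | rfl | rfl
    · obtain rfl | rfl | rfl | rfl : i = 0 ∨ i = 1 ∨ i = 2 ∨ i = 3 := by omega
      · exact Or.inl rfl
      · exact Or.inr (Or.inr ⟨1, 1, by omega, by rw [hl]; omega, rfl⟩)
      · exact Or.inr (Or.inl rfl)
      · exact Or.inr (Or.inr ⟨2, 1, by omega, by rw [hl]; omega, rfl⟩)
    · exact Or.inr (Or.inr ⟨0, 1, by omega, by rw [hl]; omega, rfl⟩)
    · exact Or.inr (Or.inr ⟨3, 1, by omega, by rw [hl]; omega, rfl⟩)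
  · intro i j hj
    rw [hl] at hj
    obtain rfl | rfl : j = 0 ∨ j = 1 := by omega
    · exact hmid0 i
    · exact hmid2 i
  · intro x y hxy
    simp only [hl]
    have swap : (∃ i : Fin 4, ∃ j < 2, s(y, x) = s(P i j, P i (j + 1))) →
        ∃ i : Fin 4, ∃ j < 2, s(x, y) = s(P i j, P i (j + 1)) := by
      rw [Sym2.eq_swap]; exact id
    rcases hcov x with hx | hx | hx
    · rcases hcov y with hy | hy | hy
      · obtain ⟨i, hi, rfl⟩ := hx
        obtain ⟨j, hj, rfl⟩ := hy
        rcases hu.adj_cases hi hj hxy with ⟨k, hk, e⟩ | h | h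
        · rw [e]
          obtain rfl | rfl | rfl | rfl : k = 0 ∨ k = 1 ∨ k = 2 ∨ k = 3 := by omega
          · exact ⟨1, 0, by omega, rfl⟩
          · exact ⟨1, 1, by omega, rfl⟩
          · exact ⟨2, 1, by omega, Sym2.eq_swap⟩
          · refine ⟨2, 0, by omega, ?_⟩
            rw [show (3 : ℕ) + 1 = 4 by rfl, h4]; exact Sym2.eq_swap
        · exact absurd h (hch _ _)
        · exact absurd h (hch _ _)
      · subst hy; exact swap (hout y 0 x rfl hv hv₀ hv₂ hxy.symm hx)
      · subst hy; exact swap (hout y 3 x rfl hw hw₀ hw₂ hxy.symm hx)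
    · subst hx
      rcases hcov y with hy | rfl | rfl
      · exact hout x 0 y rfl hv hv₀ hv₂ hxy hy
      · exact absurd hxy (G.irrefl)
      · exact absurd hxy hnadj
    · subst hx
      rcases hcov y with hy | rfl | rfl
      · exact hout x 3 y rfl hw hw₀ hw₂ hxy hy
      · exact absurd hxy.symm hnadj
      · exact absurd hxy (G.irrefl)

/-! ### Classification according to the longest cycle -/

/-- The case of a longest cycle that misses a vertex. -/
theorem IsCyc.nonempty_iso_of_not_mem [Fintype V] (hcard : 3 ≤ Fintype.card V)
    (hconn : G.IsTwoConnected) (hG : G.IsChoosable 4 2) (hu : G.IsCyc n u)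
    (hmax : ∀ n' u', G.IsCyc n' u' → n' ≤ n) {v : V} (hv : ∀ i < n, u i ≠ v) {a : ℕ}
    (h₀ : G.Adj v (u 0)) (h₁ : G.Adj v (u a)) (ha : 0 < a) (han : a < n) :
    (∃ s t : ℕ, 1 ≤ s ∧ 1 ≤ t ∧ Nonempty (G ≃g thetaGraph ![2, 2 * s, 2 * t])) ∨
      Nonempty (G ≃g thetaGraph ![2, 2, 2, 2]) := by
  obtain ⟨c, hc⟩ := hG.exists_parity
  have hn := hu.even hc
  have hn3 := hu.three_le
  have hpar := hu.neighbors_parity hc h₀ h₁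
  have hch : ∀ i j, ¬ IsChord G n u i j := by
    intro i j h
    obtain ⟨p, q, hpq, hq, hp', hq'⟩ := (hu.rotate i).exists_neighbors hcard hconn hG hmax
      (hu.not_mem_rotate hv i)
    exact (hu.rotate i).false_of_chord_of_vertex hG (hu.not_mem_rotate hv i) (h.rotate hu hc)
      hp' hq' hpq hq
  by_cases hw : ∃ w, w ≠ v ∧ ∀ i < n, u i ≠ w
  · right
    obtain ⟨w, hwv, hw⟩ := hw
    obtain ⟨p, q, hpq, hq, hp', hq'⟩ := hu.exists_neighbors hcard hconn hG hmax hw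
    have h6 : ¬ 6 ≤ n := fun h6 =>
      hu.false_of_two_vertices hG hv hw hwv.symm h₀ h₁ hp' hq' ha han hpq hq h6
    obtain rfl : n = 4 := by omega
    obtain rfl : a = 2 := by omega
    obtain ⟨hw₀, hw₂⟩ := hu.adj_of_four hcard hconn hG hmax hv hw hwv.symm h₀ h₁
    refine hu.nonempty_iso_theta_two_two_two_two hG hch hv hw hwv.symm h₀ h₁ hw₀ hw₂
      (hu.not_adj_of_not_mem hconn hG hmax hv hw) fun x => ?_
    by_contra hcon
    push Not at hcon
    obtain ⟨hx, hxv, hxw⟩ := hcon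
    obtain ⟨hx₀, hx₂⟩ := hu.adj_of_four hcard hconn hG hmax hv hx hxv.symm h₀ h₁
    refine hu.false_of_three_vertices hG (fun t => if t = 0 then v else if t = 1 then w else x)
      ?_ ?_ ?_ ?_
    · intro s hs t ht e
      interval_cases s <;> interval_cases t <;> simp_all
    all_goals
      intro t ht
      interval_cases t
    exacts [hv, hw, hx, h₀, hw₀, hx₀, h₁, hw₂, hx₂]
  · left
    push Not at hw
    have hcov : ∀ x, (∃ i < n, u i = x) ∨ x = v := by
      intro x
      by_cases h : x = v
      · exact Or.inr h
      · exact Or.inl (hw x h)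
    refine ⟨a / 2, (n - a) / 2, by omega, by omega, ?_⟩
    rw [show 2 * (a / 2) = a by omega, show 2 * ((n - a) / 2) = n - a by omega]
    have hvE : ∀ b < n, G.Adj v (u b) → b = 0 ∨ b = a := fun b hb h =>
      hu.neighbor_eq_or_eq hG hv h₀ h₁ h ha han hb
    let p : ℕ → V := fun t => if t = 0 then u 0 else if t = 1 then v else u a
    have hvE' : ∀ y, G.Adj v y → ∃ t < 2, s(v, y) = s(p t, p (t + 1)) := by
      intro y hy
      rcases hcov y with ⟨b, hb, rfl⟩ | rfl
      · rcases hvE b hb hy with rfl | rfl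
        · exact ⟨0, by omega, Sym2.eq_swap⟩
        · exact ⟨1, by omega, rfl⟩
      · exact absurd hy (G.irrefl)
    refine hu.nonempty_iso_thetaGraph (p := p) (ℓ := 2) ha han rfl rfl ?_ ?_ ?_ ?_ ?_
    · intro t ht
      obtain rfl | rfl : t = 0 ∨ t = 1 := by omega
      · exact h₀.symm
      · exact h₁
    · intro s t _ _ _ _ _
      omega
    · intro t ht ht'
      obtain rfl : t = 1 := by omega
      exact hv
    · intro x
      rcases hcov x with h | rfl
      · exact Or.inl h
      · exact Or.inr ⟨1, by omega, by omega, rfl⟩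
    · intro x y hxy
      rcases hcov x with ⟨i, hi, rfl⟩ | rfl
      · rcases hcov y with ⟨j, hj, rfl⟩ | rfl
        · rcases hu.adj_cases hi hj hxy with h | h | h
          · exact Or.inl h
          · exact absurd h (hch _ _)
          · exact absurd h (hch _ _)
        · rw [Sym2.eq_swap]
          exact Or.inr (hvE' _ hxy.symm)
      · exact Or.inr (hvE' _ hxy)

/-- A spanning cycle with the chords `{0, 3}` and `{1, 4}` has no further chords. -/
theorem IsCyc.nonempty_iso_of_two_chords (hG : G.IsChoosable 4 2) (hu : G.IsCyc n u)
    (hcov : ∀ v, ∃ i < n, u i = v) (hn : 6 ≤ n) (h₀ : G.Adj (u 0) (u 3))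
    (h₁ : G.Adj (u 1) (u 4)) :
    ∃ N, Even N ∧ Nonempty (G ≃g K33MinusEdge.subdivideEdge (Sum.inl 0) (Sum.inr 1) N) := by
  obtain ⟨c, hc⟩ := hG.exists_parity
  have hev := hu.even hc
  obtain ⟨N, rfl⟩ := Nat.exists_eq_add_of_le' hn
  refine ⟨N, Nat.even_iff.2 (by omega), hu.nonempty_iso_subdivideEdge hcov h₀ h₁ ?_⟩
  intro i j hij hj h
  by_contra hcon
  push Not at hcon
  have c0 : IsChord G (N + 6) u 0 3 := ⟨h₀, by omega, by omega, by omega⟩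
  have c1 : IsChord G (N + 6) u 1 4 := ⟨h₁, by omega, by omega, by omega⟩
  have c2 : IsChord G (N + 6) u i j := ⟨h, by omega, hj, by omega⟩
  -- Compatibility with the chord {0, 3} forces a third chord to be {2, n - 1}; compatibility with
  -- {1, 4}, after rotation by 1, then forces n = 6, and the graph contains K_{3,3}.
  have e := c0.crossing hG hu c2 (by omega)
  obtain ⟨rfl, hj'⟩ : i = 2 ∧ N + 6 = j + 1 := by omega
  have c2' : IsChord G (N + 6) (fun t => u (t + 1)) 1 (j - 1) := by
    refine ⟨?_, by omega, by omega, by omega⟩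
    beta_reduce
    rw [Nat.sub_add_cancel (by omega)]; exact h
  have e' := (c1.rotate hu hc).crossing hG (hu.rotate 1) c2' (by omega)
  obtain rfl : N = 0 := by omega
  obtain rfl : j = 5 := by omega
  exact hu.false_of_three_chords hG h₀ h₁ h

/-- The case of a spanning cycle with a chord. -/
theorem IsCyc.nonempty_iso_of_chord (hG : G.IsChoosable 4 2) (hu : G.IsCyc n u)
    (hcov : ∀ v, ∃ i < n, u i = v) {a : ℕ} (ha : IsChord G n u 0 a) :
    (∃ s t : ℕ, 1 ≤ s ∧ 1 ≤ t ∧ Nonempty (G ≃g thetaGraph ![1, 2 * s + 1, 2 * t + 1])) ∨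
      ∃ N, Even N ∧ Nonempty (G ≃g K33MinusEdge.subdivideEdge (Sum.inl 0) (Sum.inr 1) N) := by
  obtain ⟨c, hc⟩ := hG.exists_parity
  have hn := hu.even hc
  have hpar := ha.odd hu hc
  obtain ⟨hadj, b1, b2, b3⟩ := id ha
  by_cases h : ∃ p q, IsChord G n u p q ∧ ¬ (p = 0 ∧ q = a)
  · right
    obtain ⟨p, q, hpq, hne⟩ := h
    have h0 : ∀ i, u (i + n) = u i := hu.per
    -- In each case of `crossing` three consecutive arcs have lengths 1, 2, 1. Rotating to the start
    -- of the first one turns the chords into {0, 3} and {1, 4}.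
    have hrot : ∀ k, G.Adj (u k) (u (3 + k)) → G.Adj (u (1 + k)) (u (4 + k)) →
        ∃ N, Even N ∧
          Nonempty (G ≃g K33MinusEdge.subdivideEdge (Sum.inl 0) (Sum.inr 1) N) := by
      intro k h1 h2
      exact (hu.rotate k).nonempty_iso_of_two_chords hG (fun v => hu.exists_rotate k (hcov v))
        (by omega) (by simpa using h1) h2
    have hadj' := hpq.1
    have e00 : u n = u 0 := by simpa using h0 0
    rcases ha.crossing hG hu hpq hne with ⟨rfl, rfl, rfl | h2⟩ | ⟨rfl, h2, rfl | rfl⟩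
    · exact hrot 0 hadj hadj'
    · refine hrot a ?_ ?_
      · rw [show 3 + a = n by omega, e00]; exact hadj.symm
      · rw [show 4 + a = 1 + n by omega, h0, add_comm 1 a]; exact hadj'.symm
    · refine hrot q ?_ ?_
      · rw [show 3 + q = 2 + n by omega, h0]; exact hadj'.symm
      · rw [show 1 + q = n by omega, e00, show 4 + q = 3 + n by omega, h0]; exact hadj
    · refine hrot p ?_ ?_
      · rw [show 3 + p = p + 1 + 2 by omega]; exact hadj'
      · rw [show 4 + p = n by omega, e00, add_comm 1 p]; exact hadj.symm
  · left
    push Not at h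
    refine ⟨a / 2, (n - a) / 2, by omega, by omega, ?_⟩
    rw [show 2 * (a / 2) + 1 = a by omega, show 2 * ((n - a) / 2) + 1 = n - a by omega]
    refine hu.nonempty_iso_thetaGraph (p := fun t => if t = 0 then u 0 else u a) (ℓ := 1)
      (by omega) b2 rfl rfl ?_ ?_ ?_ (fun v => Or.inl (hcov v)) ?_
    · intro t ht
      obtain rfl : t = 0 := by omega
      exact hadj
    · intro s t _ _ _ _ _
      omega
    · intro t _ _
      omega
    · intro x y hxy
      obtain ⟨i, hi, rfl⟩ := hcov x
      obtain ⟨j, hj, rfl⟩ := hcov y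
      rcases hu.adj_cases hi hj hxy with h' | h' | h'
      · exact Or.inl h'
      · obtain ⟨rfl, rfl⟩ := h i j h'
        exact Or.inr ⟨0, by omega, rfl⟩
      · obtain ⟨rfl, rfl⟩ := h j i h'
        exact Or.inr ⟨0, by omega, Sym2.eq_swap⟩

end SimpleGraph

theorem mainTheorem3 {V : Type*} [Fintype V] (G : SimpleGraph V)
    (hcard : 3 ≤ Fintype.card V) (hconn : G.IsTwoConnected) (hchoose : G.IsChoosable 4 2) :
    (∃ s : ℕ, 2 ≤ s ∧ Nonempty (G ≃g SimpleGraph.cycleGraph (2 * s))) ∨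
    (∃ s t : ℕ, 1 ≤ s ∧ 1 ≤ t ∧ Nonempty (G ≃g SimpleGraph.thetaGraph ![2, 2 * s, 2 * t])) ∨
    (∃ s t : ℕ, 1 ≤ s ∧ 1 ≤ t ∧
      Nonempty (G ≃g SimpleGraph.thetaGraph ![1, 2 * s + 1, 2 * t + 1])) ∨
    Nonempty (G ≃g SimpleGraph.thetaGraph ![2, 2, 2, 2]) ∨
    (∃ (u v : Fin 3 ⊕ Fin 3) (n : ℕ), SimpleGraph.K33MinusEdge.Adj u v ∧
      (SimpleGraph.K33MinusEdge.neighborSet u).ncard = 2 ∧ Even n ∧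
      Nonempty (G ≃g SimpleGraph.K33MinusEdge.subdivideEdge u v n)) := by
  obtain ⟨c, hc⟩ := hchoose.exists_parity
  obtain ⟨n, u, hu, hmax⟩ := hconn.exists_longest_cyc hcard
  have hn := hu.even hc
  have hn3 := hu.three_le
  by_cases hv : ∃ v, ∀ i < n, u i ≠ v
  · obtain ⟨v, hv⟩ := hv
    obtain ⟨p, q, hpq, hq, hp', hq'⟩ := hu.exists_neighbors hcard hconn hchoose hmax hv
    rcases (hu.rotate p).nonempty_iso_of_not_mem hcard hconn hchoose hmax (hu.not_mem_rotate hv p)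
      (a := q - p) (by simpa using hp') (by rwa [Nat.sub_add_cancel hpq.le]) (by omega) (by omega)
      with h | h
    · exact Or.inr (Or.inl h)
    · exact Or.inr (Or.inr (Or.inr (Or.inl h)))
  · push Not at hv
    by_cases hch : ∃ i j, SimpleGraph.IsChord G n u i j
    · obtain ⟨i, j, hij⟩ := hch
      rcases (hu.rotate i).nonempty_iso_of_chord hchoose (fun v => hu.exists_rotate i (hv v))
        (hij.rotate hu hc) with h | ⟨N, hN, h⟩
      · exact Or.inr (Or.inr (Or.inl h))
      · exact Or.inr (Or.inr (Or.inr (Or.inr ⟨_, _, N, SimpleGraph.K33MinusEdge_adj_zero_one,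
          SimpleGraph.ncard_neighborSet_K33MinusEdge, hN, h⟩)))
    · push Not at hch
      refine Or.inl ⟨n / 2, by omega, ?_⟩
      rw [show 2 * (n / 2) = n by omega]
      refine hu.nonempty_iso_cycleGraph hv fun i j hij hj h => ?_
      by_contra hcon
      exact hch i j ⟨h, by omega, hj, by omega⟩
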